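/- **Conventions.** Operations over a field $\mathbb F$ are counted by division-free straight-line programs over $\mathbb F$: each $+$, $-$, $\times$ costs one operation; constants of $\mathbb F$, inputs and stored results are read for free. Let $\omega$ and $K$ be real numbers such that, for all $n\ge 1$, two $n\times n$ matrices can be multiplied with at most $K n^{\omega}$ operations (by a straight-line program over $\mathbb F$ that is valid over every commutative $\mathbb F$-algebra). Let $\mathcal M:\mathbb N\to\mathbb R$ be such that, for all $n$, two polynomials of degree at most $n$ over $\mathbb F$ can be multiplied with at most $\mathcal M(n)$ operations, and $\mathcal M(a)+\mathcal M(b)\le \mathcal M(a+b)$ for all $a,b\ge 1$. **Modular recurrence of width $(t,1)$ and degree $(1,0)$.** Let $m,c,d\in\mathbb F^N$, let $\mathbf R$ be the $N\times N$ companion matrix (ones on the subdiagonal, last column $m$, zeros elsewhere), with characteristic polynomial $c_{\mathbf R}(X)=X^N-\sum_{k<N}m_kX^k$, let $d(X)=\sum_{k<N}d_kX^k$, and let $g_{i,j}\in\mathbb F[X]$ ($0\le i<N$, $1\le j\le t$) satisfy $\deg g_{i,j}\le j$. A matrix $\mathbf A\in\mathbb F^{N\times N}$ satisfies the modular recurrence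 with generators $(g,c,d,m)$ if the polynomials $a_i(X)=\sum_{k<N}\mathbf A[i,k]X^k$ satisfy $$a_i(X)=\sum_{j=1}^{\min(t,i)}g_{i,j}(X)\,a_{i-j}(X)+c_i\,d(X)\pmod{c_{\mathbf R}(X)}\qquad(0\le i<N),$$ where the right-hand side denotes the remainder on division by $c_{\mathbf R}(X)$. **Theorem.** There is a constant $B$, depending only on $\omega$ and $K$, such that for all $\mathbb F$ and $\mathcal M$ as above and all integers $N\ge 2$, $t\ge 1$ there are * a pre-processing program with at most $B\,t^{\omega}\mathcal M(N)\log N$ operations, whose input consists of the coefficients of the $g_{i,j}$ and the entries of $c,d,m$, and * a second program with at most $B\,t^{2}\mathcal M(N)\log N$ operations, which has access to the same input, to all results of the pre-processing, and to a vector $b\in\mathbb F^N$, such that, for all generators $(g,c,d,m)$, every $\mathbf A$ that satisfies the corresponding recurrence, and every $b\in\mathbb F^N$, the second program, run after the first, outputs $\mathbf A^Tb$. -/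

import Mathlib

open Polynomial

universe u

/-! ### Straight-line programs over a field, and the number of their operations -/

/-- The three ring operations of a straight-line program. -/
inductive ArithOp
  | add
  | sub
  | mul

/-- The operand of an instruction: a constant of the field, an input variable, or the result of an
earlier instruction (results are numbered `0, 1, 2, …` in the order in which they are computed). -/
inductive Operand (F ι : Type*)
  | const (a : F)
  | input (i : ι)
  | reg (k : ℕ)

/-- One instruction: an operation applied to two operands. -/
structure Instr (F ι : Type*) where
  op : ArithOp
  lhs : Operand F ι
  rhs : Operand F ι

/-- A (division-free) straight-line program over `F` with input variables indexed by `ι`. Every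
instruction is exactly one arithmetic operation, so the number of operations of the program `P`
is `P.length`; constants, inputs and stored results are read free of charge. -/
abbrev SLP (F ι : Type*) := List (Instr F ι)

/-- The value of an operation on two ring elements. -/
def ArithOp.apply {R : Type*} [CommRing R] : ArithOp → R → R → R
  | .add, a, b => a + b
  | .sub, a, b => a - b
  | .mul, a, b => a * b

/-- The value of an operand in a commutative `F`-algebra `R`, for the input values `x` and the list
`mem` of results computed so far. (A reference beyond the end of the list reads as `0`.) -/
def Operand.eval {F ι R : Type*} [Field F] [CommRing R] [Algebra F R]
    (x : ι → R) (mem : List R) : Operand F ι → R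
  | .const a => algebraMap F R a
  | .input i => x i
  | .reg k => mem.getD k 0

/-- The value of an instruction. -/
def Instr.eval {F ι R : Type*} [Field F] [CommRing R] [Algebra F R]
    (x : ι → R) (mem : List R) (I : Instr F ι) : R :=
  I.op.apply (I.lhs.eval x mem) (I.rhs.eval x mem)

/-- Run a program on the input values `x`, starting with the list `mem` of results already stored;
each instruction appends its value to the list. -/
def SLP.run {F ι R : Type*} [Field F] [CommRing R] [Algebra F R]
    (P : SLP F ι) (x : ι → R) (mem : List R) : List R :=
  P.foldl (fun mem I => mem ++ [I.eval x mem]) mem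

/-! ### The cost of polynomial multiplication and of matrix multiplication -/

/-- The polynomial with a given coefficient vector. -/
noncomputable def vecPoly {F : Type*} [Field F] {n : ℕ} (v : Fin n → F) : F[X] :=
  ∑ i : Fin n, C (v i) * X ^ (i : ℕ)

/-- `M n` operations suffice to multiply two polynomials of degree at most `n` over `F`: from the
two vectors of `n + 1` coefficients, a straight-line program with at most `M n` operations computes
the `2 n + 1` coefficients of the product. -/
def IsPolyMulCost (F : Type*) [Field F] (M : ℕ → ℝ) : Prop :=
  ∀ n : ℕ, ∃ (P : SLP F (Fin (n + 1) ⊕ Fin (n + 1)))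
    (out : Fin (2 * n + 1) → Operand F (Fin (n + 1) ⊕ Fin (n + 1))),
    (P.length : ℝ) ≤ M n ∧
    ∀ (p q : Fin (n + 1) → F) (k : Fin (2 * n + 1)),
      (out k).eval (Sum.elim p q) (P.run (Sum.elim p q) []) = (vecPoly p * vecPoly q).coeff k

/-- `n × n` matrices can be multiplied with at most `K * n ^ ω` operations, by straight-line programs
over `F`. As usual for the exponent of matrix multiplication, such a program is a formal
computation: it multiplies matrices over every commutative `F`-algebra (equivalently, it
multiplies two matrices of indeterminates over `F`). -/
def IsMatMulExponent (F : Type u) [Field F] (ω K : ℝ) : Prop :=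
  ∀ n : ℕ, 1 ≤ n → ∃ (P : SLP F ((Fin n × Fin n) ⊕ (Fin n × Fin n)))
    (out : Fin n → Fin n → Operand F ((Fin n × Fin n) ⊕ (Fin n × Fin n))),
    (P.length : ℝ) ≤ K * (n : ℝ) ^ ω ∧
    ∀ (R : Type u) [CommRing R] [Algebra F R] (Y Z : Matrix (Fin n) (Fin n) R) (i j : Fin n),
      (out i j).eval (Sum.elim (fun a => Y a.1 a.2) (fun a => Z a.1 a.2))
        (P.run (Sum.elim (fun a => Y a.1 a.2) (fun a => Z a.1 a.2)) []) = (Y * Z) i j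

/-! ### Modular recurrences of width `(t, 1)` and degree `(1, 0)` -/

/-- The `N × N` companion matrix: ones below the diagonal, last column `m`. -/
def companion {F : Type*} [Field F] {N : ℕ} (m : Fin N → F) : Matrix (Fin N) (Fin N) F :=
  Matrix.of fun i j =>
    if (j : ℕ) + 1 = N then m i else if (i : ℕ) = (j : ℕ) + 1 then 1 else 0

/-- The characteristic polynomial of the companion matrix is `X ^ N - ∑ i, m i * X ^ i`. -/
theorem charpoly_companion {F : Type*} [Field F] {N : ℕ} (m : Fin N → F) :
    (companion m).charpoly = X ^ N - vecPoly m := by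
  have hlt : (vecPoly m).degree < N := by
    refine lt_of_le_of_lt (degree_sum_le _ _) ?_
    refine (Finset.sup_lt_iff (WithBot.bot_lt_coe N)).2 fun i _ => ?_
    exact lt_of_le_of_lt (degree_C_mul_X_pow_le _ _) (Nat.cast_lt.2 i.2)
  have hmon : (X ^ N - vecPoly m).Monic := monic_X_pow_sub hlt
  have hnat : (X ^ N - vecPoly m).natDegree = N := by
    refine natDegree_eq_of_degree_eq_some ?_
    rw [degree_sub_eq_left_of_degree_lt (by rwa [degree_X_pow]), degree_X_pow]
  have hcoeff : ∀ i : Fin N, (X ^ N - vecPoly m).coeff i = - m i := by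
    intro i
    have h1 : (i : ℕ) ≠ N := i.2.ne
    simp [vecPoly, coeff_X_pow, h1, Fin.val_inj]
  generalize X ^ N - vecPoly m = f at hmon hnat hcoeff
  subst hnat
  let pb := AdjoinRoot.powerBasis hmon.ne_zero
  have hmp : minpoly F pb.gen = f := AdjoinRoot.minpoly_powerBasis_gen_of_monic hmon
  have hM : companion m = Algebra.leftMulMatrix pb.basis pb.gen := by
    rw [PowerBasis.leftMulMatrix, pb.minpolyGen_eq, hmp]
    ext i j
    simp only [companion, Matrix.of_apply]
    have h2 := hcoeff i
    have h3 : m i = -f.coeff i := by rw [h2, neg_neg]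
    rw [h3]
    rfl
  rw [hM]
  exact (charpoly_leftMulMatrix pb).trans hmp

/-- The generators of a modular recurrence of size `N`, width `(t, 1)` and degree `(1, 0)`:
polynomials `g i j` with `deg (g i j) ≤ j` for `0 ≤ i < N`, `1 ≤ j ≤ t`
(the coefficient `g i 0` is `1`); vectors `c` and `d`, which give the error matrix `c dᵀ`; and the
last column `m` of the companion matrix. -/
structure RecurrenceData (F : Type*) [Field F] (N t : ℕ) where
  g : Fin N → ℕ → F[X]
  c : Fin N → F
  d : Fin N → F
  m : Fin N → F
  natDegree_g_le : ∀ (i : Fin N) (j : ℕ), 1 ≤ j → j ≤ t → (g i j).natDegree ≤ j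

/-- The modulus: the characteristic polynomial of the companion matrix. -/
noncomputable def RecurrenceData.modulus {F : Type*} [Field F] {N t : ℕ}
    (D : RecurrenceData F N t) : F[X] :=
  (companion D.m).charpoly

/-- The polynomial `a i` whose coefficient vector is row `i` of `A`. -/
noncomputable def rowPoly {F : Type*} [Field F] {N : ℕ} (A : Matrix (Fin N) (Fin N) F)
    (i : ℕ) : F[X] :=
  if h : i < N then vecPoly (A ⟨i, h⟩) else 0

/-- The rows of `A` satisfy the recurrence
`a i = ∑_{1 ≤ j ≤ min t i} g i j * a (i - j) + c i * d  (mod modulus)`. -/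
def RecurrenceData.Generates {F : Type*} [Field F] {N t : ℕ} (D : RecurrenceData F N t)
    (A : Matrix (Fin N) (Fin N) F) : Prop :=
  ∀ i : Fin N,
    rowPoly A i =
      (∑ j ∈ Finset.Icc 1 (min t (i : ℕ)), D.g i j * rowPoly A ((i : ℕ) - j)
        + C (D.c i) * vecPoly D.d) %ₘ D.modulus

/-- Names of the field elements by which the generators are given to an algorithm:
`g i j k` is the coefficient of `X ^ k` in the polynomial with index `(i, j + 1)`, where
`0 ≤ k ≤ j + 1`. -/
inductive GenIndex (N t : ℕ)
  | g (i : Fin N) (j : Fin t) (k : Fin ((j : ℕ) + 2))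
  | c (i : Fin N)
  | d (i : Fin N)
  | m (i : Fin N)

/-- The input values of an algorithm that is given the generators. -/
noncomputable def RecurrenceData.inputs {F : Type*} [Field F] {N t : ℕ}
    (D : RecurrenceData F N t) : GenIndex N t → F
  | .g i j k => (D.g i ((j : ℕ) + 1)).coeff k
  | .c i => D.c i
  | .d i => D.d i
  | .m i => D.m i

/-! ### Computations as relations between sets of ring elements -/

/-! Let `y i` solve the recurrence over `F[X]` without the modulus and with the constants `c i` in
place of `c i * d`. Since reduction is compatible with the recurrence, row `i` of `A` is `y i * d`
modulo the characteristic polynomial (`RecurrenceData.Generates.coeff_modByMonic`). Hence `Aᵀ b` is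
the coefficient vector of `s * d` modulo that polynomial, where `s = ∑ b i * y i` has degree less
than `N`.

To find `s`, put `T = min t N` and collect the `y i` in blocks of `T`, preceded by the constant `1`.
A block `z (I + 1)` satisfies `z (I + 1) = L z (I + 1) + U z I` with `L` strictly lower triangular,
so `z (I + 1) = (1 - L)⁻¹ U z I`, and the inverse is a finite geometric series evaluated by repeated
squaring (`blockTransition_mulVec`). The pre-processing builds the binary tree of products of these
transition matrices. Given `b`, only row vectors travel up the tree (`rowTree_zero_eq_sum`), which
replaces matrix products by vector-matrix products and `t ^ ω` by `t ^ 2`. Weighted degrees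
(`WeightedDegreeLE`) keep the entries on level `l` at degree `O(2 ^ l * T)`, and superadditivity of
`M` bounds the polynomial multiplications of a whole level by `M N` times the cost of one matrix
operation (`level_cost_le`); there are `O(log N)` levels. Division with remainder uses a power
series inverse of the reversed modulus, which is also pre-processed (`Computes.modByMonic`).

Costs are handled by the relation `Computes` between sets of ring elements, which composes without
register bookkeeping. It is applied in the ring of `F`-valued functions on the set of all instances.
One computation there is one program for all instances, because programs commute with evaluation
(`SLP.map_run`); and multiplication programs known to be correct over `F` only remain correct in
this ring. -/

theorem SLP.run_nil {F ι R : Type*} [Field F] [CommRing R] [Algebra F R] (x : ι → R)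
    (mem : List R) : SLP.run ([] : SLP F ι) x mem = mem := rfl

theorem SLP.run_cons {F ι R : Type*} [Field F] [CommRing R] [Algebra F R] (I : Instr F ι)
    (P : SLP F ι) (x : ι → R) (mem : List R) :
    SLP.run (I :: P) x mem = SLP.run P x (mem ++ [I.eval x mem]) := rfl

theorem SLP.run_append {F ι R : Type*} [Field F] [CommRing R] [Algebra F R] (P Q : SLP F ι)
    (x : ι → R) (mem : List R) :
    SLP.run (P ++ Q) x mem = SLP.run Q x (SLP.run P x mem) :=
  List.foldl_append

theorem SLP.exists_run_eq_append {F ι R : Type*} [Field F] [CommRing R] [Algebra F R]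
    (P : SLP F ι) (x : ι → R) : ∀ mem : List R, ∃ l, P.run x mem = mem ++ l := by
  induction P with
  | nil => exact fun mem => ⟨[], by simp [SLP.run_nil]⟩
  | cons I P ih =>
    intro mem
    obtain ⟨l, hl⟩ := ih (mem ++ [I.eval x mem])
    exact ⟨I.eval x mem :: l, by rw [SLP.run_cons, hl]; simp⟩

theorem SLP.length_run {F ι R : Type*} [Field F] [CommRing R] [Algebra F R]
    (P : SLP F ι) (x : ι → R) : ∀ mem : List R, (P.run x mem).length = mem.length + P.length := by
  induction P with
  | nil => intro mem; simp [SLP.run_nil]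
  | cons I P ih =>
    intro mem
    rw [SLP.run_cons, ih]
    simp only [List.length_append, List.length_cons, List.length_nil]
    omega

theorem Operand.map_eval {F ι R R' : Type*} [Field F] [CommRing R] [Algebra F R] [CommRing R']
    [Algebra F R'] (φ : R →ₐ[F] R') (o : Operand F ι) (x : ι → R) (mem : List R) :
    φ (o.eval x mem) = o.eval (fun i => φ (x i)) (mem.map φ) := by
  cases o with
  | const a => simp [Operand.eval]
  | input i => rfl
  | reg k =>
    simp only [Operand.eval, List.getD_eq_getElem?_getD, List.getElem?_map]
    cases mem[k]? <;> simp

theorem Instr.map_eval {F ι R R' : Type*} [Field F] [CommRing R] [Algebra F R] [CommRing R']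
    [Algebra F R'] (φ : R →ₐ[F] R') (I : Instr F ι) (x : ι → R) (mem : List R) :
    φ (I.eval x mem) = I.eval (fun i => φ (x i)) (mem.map φ) := by
  obtain ⟨op, l, r⟩ := I
  cases op <;> simp [Instr.eval, ArithOp.apply, Operand.map_eval]

/-- Programs consist of ring operations and constants of `F`, so they commute with algebra
homomorphisms. The homomorphisms that matter later are the evaluations of functions at a point. -/
theorem SLP.map_run {F ι R R' : Type*} [Field F] [CommRing R] [Algebra F R] [CommRing R']
    [Algebra F R'] (φ : R →ₐ[F] R') (P : SLP F ι) (x : ι → R) : ∀ mem : List R,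
    (P.run x mem).map φ = P.run (fun i => φ (x i)) (mem.map φ) := by
  induction P with
  | nil => intro mem; rfl
  | cons I P ih =>
    intro mem
    rw [SLP.run_cons, SLP.run_cons, ih, List.map_append, List.map_cons, Instr.map_eval]
    rfl

/-- `a` is the value of some operand, for the input values `x` and the stored results `mem`. -/
def Readable (F : Type*) [Field F] {ι R : Type*} [CommRing R] [Algebra F R]
    (x : ι → R) (mem : List R) (a : R) : Prop :=
  ∃ o : Operand F ι, o.eval x mem = a

section Readable

variable {F : Type*} [Field F] {ι R : Type*} [CommRing R] [Algebra F R]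

theorem readable_algebraMap (x : ι → R) (mem : List R) (a : F) :
    Readable F x mem (algebraMap F R a) := ⟨.const a, rfl⟩

theorem readable_of_mem (x : ι → R) {mem : List R} {a : R} (h : a ∈ mem) :
    Readable F x mem a := by
  obtain ⟨k, hk, rfl⟩ := List.mem_iff_getElem.1 h
  exact ⟨.reg k, by simp [Operand.eval, hk]⟩

/-- A reference beyond the end of memory reads as `0`, which is a constant. Such an operand may
change its value when memory grows, but the value remains readable through another operand; this
makes `Readable.append` true. -/
theorem Readable.cases {x : ι → R} {mem : List R} {a : R} (h : Readable F x mem a) :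
    a ∈ Set.range (algebraMap F R) ∨ a ∈ Set.range x ∨ a ∈ mem := by
  obtain ⟨o, rfl⟩ := h
  cases o with
  | const a => exact Or.inl ⟨a, rfl⟩
  | input i => exact Or.inr (Or.inl ⟨i, rfl⟩)
  | reg k =>
    by_cases hk : k < mem.length
    · refine Or.inr (Or.inr ?_)
      simp [Operand.eval, hk]
    · exact Or.inl ⟨0, by
        rw [map_zero]; exact (List.getD_eq_default _ _ (not_lt.1 hk)).symm⟩

theorem Readable.append {x : ι → R} {mem : List R} {a : R} (h : Readable F x mem a)
    (l : List R) : Readable F x (mem ++ l) a := by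
  rcases h.cases with ⟨b, rfl⟩ | ⟨i, rfl⟩ | h
  · exact readable_algebraMap x _ b
  · exact ⟨.input i, rfl⟩
  · exact readable_of_mem x (List.mem_append_left l h)

theorem Readable.run {x : ι → R} {mem : List R} {a : R} (h : Readable F x mem a)
    (P : SLP F ι) : Readable F x (P.run x mem) a := by
  obtain ⟨l, hl⟩ := P.exists_run_eq_append x mem
  rw [hl]
  exact h.append l

end Readable

/-- The elements of `S` and the constants. -/
def withConst (F : Type*) [Field F] {R : Type*} [CommRing R] [Algebra F R] (S : Set R) : Set R :=
  S ∪ Set.range (algebraMap F R)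

/-- Whenever all elements of `S` can be read, at most `c` operations make all elements of `T`
readable. -/
def Computes (F : Type*) [Field F] {R : Type*} [CommRing R] [Algebra F R] (S T : Set R)
    (c : ℝ) : Prop :=
  ∀ (ι : Type) (x : ι → R) (mem : List R), (∀ a ∈ S, Readable F x mem a) →
    ∃ P : SLP F ι, (P.length : ℝ) ≤ c ∧ ∀ a ∈ T, Readable F x (P.run x mem) a

section Computes

variable {F : Type*} [Field F] {R : Type*} [CommRing R] [Algebra F R] {S S' T T' U : Set R}
  {c c' : ℝ}

theorem zero_mem_withConst : (0 : R) ∈ withConst F S := Or.inr ⟨0, map_zero _⟩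

theorem one_mem_withConst : (1 : R) ∈ withConst F S := Or.inr ⟨1, map_one _⟩

theorem withConst_mono (h : S ⊆ S') : withConst F S ⊆ withConst F S' :=
  Set.union_subset_union_left _ h

theorem readable_of_mem_withConst {ι : Type*} {x : ι → R} {mem : List R}
    (h : ∀ a ∈ S, Readable F x mem a) {a : R} (ha : a ∈ withConst F S) : Readable F x mem a := by
  rcases ha with ha | ⟨b, rfl⟩
  · exact h a ha
  · exact readable_algebraMap x mem b

theorem Computes.mono (h : Computes F S T c) (hS : S ⊆ withConst F S')
    (hT : T' ⊆ withConst F (S' ∪ T)) (hc : c ≤ c') : Computes F S' T' c' := by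
  intro ι x mem hx
  obtain ⟨P, hP, hPT⟩ := h ι x mem fun a ha => readable_of_mem_withConst hx (hS ha)
  refine ⟨P, hP.trans hc, fun a ha => readable_of_mem_withConst (S := S' ∪ T) ?_ (hT ha)⟩
  rintro b (hb | hb)
  · exact (hx b hb).run P
  · exact hPT b hb

theorem Computes.mono_left (h : Computes F S T c) (hS : S ⊆ withConst F S') :
    Computes F S' T c :=
  h.mono hS (fun _ ha => Or.inl (Or.inr ha)) le_rfl

theorem Computes.mono_right (h : Computes F S T c) (hT : T' ⊆ withConst F T) :
    Computes F S T' c :=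
  h.mono (fun _ ha => Or.inl ha) (hT.trans (withConst_mono Set.subset_union_right)) le_rfl

theorem Computes.mono_cost (h : Computes F S T c) (hc : c ≤ c') : Computes F S T c' :=
  h.mono (fun _ ha => Or.inl ha) (fun _ ha => Or.inl (Or.inr ha)) hc

theorem Computes.of_subset (h : T ⊆ withConst F S) (hc : 0 ≤ c) : Computes F S T c :=
  fun _ x mem hx => ⟨[], by simpa using hc, fun _ ha => readable_of_mem_withConst hx (h ha)⟩

theorem Computes.trans (h : Computes F S T c) (h' : Computes F (S ∪ T) U c') :
    Computes F S (T ∪ U) (c + c') := by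
  intro ι x mem hx
  obtain ⟨P, hP, hPT⟩ := h ι x mem hx
  obtain ⟨Q, hQ, hQU⟩ := h' ι x (P.run x mem) (by
    rintro a (ha | ha)
    · exact (hx a ha).run P
    · exact hPT a ha)
  refine ⟨P ++ Q, by simpa using add_le_add hP hQ, ?_⟩
  rw [SLP.run_append]
  rintro a (ha | ha)
  · exact (hPT a ha).run Q
  · exact hQU a ha

theorem Computes.trans_right (h : Computes F S T c) (h' : Computes F (S ∪ T) U c') :
    Computes F S U (c + c') :=
  (h.trans h').mono_right fun _ ha => Or.inl (Or.inr ha)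

theorem Computes.union (h : Computes F S T c) (h' : Computes F S U c') :
    Computes F S (T ∪ U) (c + c') :=
  h.trans (h'.mono_left fun _ ha => Or.inl (Or.inl ha))

theorem Computes.biUnion {κ : Type*} (s : Finset κ) {T : κ → Set R} {c : κ → ℝ}
    (h : ∀ i ∈ s, Computes F S (T i) (c i)) :
    Computes F S (⋃ i ∈ s, T i) (∑ i ∈ s, c i) := by
  classical
  induction s using Finset.induction_on with
  | empty => exact .of_subset (by simp) (by simp)
  | insert i s hi ih =>
    rw [Finset.set_biUnion_insert, Finset.sum_insert hi]
    exact (h i (Finset.mem_insert_self i s)).union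
      (ih fun j hj => h j (Finset.mem_insert_of_mem hj))

theorem Computes.iUnion {κ : Type*} [Fintype κ] {T : κ → Set R} {c : ℝ}
    (h : ∀ i, Computes F S (T i) c) :
    Computes F S (⋃ i, T i) (Fintype.card κ * c) := by
  have := Computes.biUnion (F := F) (S := S) Finset.univ (T := T) (c := fun _ => c)
    fun i _ => h i
  simpa using this

/-- Computing a sequence of sets, each from the previous one. -/
theorem Computes.chain {X : ℕ → Set R} {c : ℝ} (n : ℕ)
    (h : ∀ l < n, Computes F (S ∪ X l) (X (l + 1)) c) (h0 : Computes F S (X 0) c') :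
    Computes F S (⋃ l ∈ Finset.range (n + 1), X l) (c' + n * c) := by
  induction n with
  | zero => simpa using h0
  | succ n ih =>
    have h1 := ih fun l hl => h l (hl.trans (Nat.lt_succ_self n))
    have h2 := h1.trans ((h n (Nat.lt_succ_self n)).mono_left
      (S' := S ∪ ⋃ l ∈ Finset.range (n + 1), X l) (by
        rintro a (ha | ha)
        · exact Or.inl (Or.inl ha)
        · exact Or.inl (Or.inr (Set.mem_biUnion (Finset.mem_coe.2 (Finset.self_mem_range_succ n))
            ha))))
    refine (h2.mono_cost (by push_cast; linarith)).mono_right ?_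
    rw [Finset.range_add_one (n := n + 1), Finset.set_biUnion_insert, Set.union_comm]
    exact fun _ ha => Or.inl ha

theorem Computes.op (op : ArithOp) (a b : R) : Computes F {a, b} {op.apply a b} 1 := by
  intro ι x mem hx
  obtain ⟨o, rfl⟩ := hx a (by simp)
  obtain ⟨o', rfl⟩ := hx b (by simp)
  refine ⟨[⟨op, o, o'⟩], by simp, ?_⟩
  rintro _ rfl
  exact readable_of_mem x (by simp [SLP.run, Instr.eval])

theorem Computes.add (a b : R) : Computes F {a, b} {a + b} 1 := .op .add a b

/-- Running a program over a ring `A` whose elements are described by sets `co a` of elements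
of `R`. -/
theorem Computes.simulate {A : Type*} [CommRing A] [Algebra F A] (co : A → Set R) {ν : ℝ}
    (hop : ∀ (op : ArithOp) (u v : A), Computes F (co u ∪ co v) (co (op.apply u v)) ν)
    (hconst : ∀ a : F, co (algebraMap F A a) ⊆ Set.range (algebraMap F R)) {κ : Type*}
    (P : SLP F κ) (y : κ → A) : ∀ (S : Set R) (mem : List A), (∀ i, co (y i) ⊆ S) →
      (∀ a ∈ mem, co a ⊆ S) →
      Computes F S (⋃ a ∈ {a | a ∈ P.run y mem}, co a) (P.length * ν) := by
  induction P with
  | nil =>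
    intro S mem _ hm
    refine .of_subset ?_ (by simp)
    simp only [Set.iUnion_subset_iff]
    exact fun a ha _ hb => Or.inl (hm a ha hb)
  | cons I P ih =>
    intro S mem hy hm
    have hread : ∀ o : Operand F κ, co (o.eval y mem) ⊆ withConst F S := by
      intro o
      rcases Readable.cases (⟨o, rfl⟩ : Readable F y mem (o.eval y mem)) with ⟨b, hb⟩ | ⟨i, hi⟩ | h
      · rw [← hb]; exact fun _ ha => Or.inr (hconst b ha)
      · rw [← hi]; exact fun _ ha => Or.inl (hy i ha)
      · exact fun _ ha => Or.inl (hm _ h ha)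
    have h1 : Computes F S (co (I.eval y mem)) ν :=
      (hop I.op _ _).mono_left (Set.union_subset (hread I.lhs) (hread I.rhs))
    have h2 := ih (S ∪ co (I.eval y mem)) (mem ++ [I.eval y mem])
      (fun i => (hy i).trans Set.subset_union_left) (by
        intro a ha
        rcases List.mem_append.1 ha with ha | ha
        · exact (hm a ha).trans Set.subset_union_left
        · rw [List.mem_singleton.1 ha]; exact Set.subset_union_right)
    refine (h1.trans_right h2).mono_cost (le_of_eq ?_)
    push_cast [List.length_cons]
    ring

theorem Computes.simulate_out {A : Type*} [CommRing A] [Algebra F A] (co : A → Set R) {ν : ℝ}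
    (hop : ∀ (op : ArithOp) (u v : A), Computes F (co u ∪ co v) (co (op.apply u v)) ν)
    (hconst : ∀ a : F, co (algebraMap F A a) ⊆ Set.range (algebraMap F R)) {κ : Type*}
    (P : SLP F κ) (y : κ → A) {S : Set R} (hy : ∀ i, co (y i) ⊆ S) {τ : Type*}
    (out : τ → Operand F κ) :
    Computes F S (⋃ k, co ((out k).eval y (P.run y []))) (P.length * ν) := by
  refine (Computes.simulate co hop hconst P y S [] hy (by simp)).mono (fun _ ha => Or.inl ha) ?_
    le_rfl
  refine Set.iUnion_subset fun k => ?_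
  rcases Readable.cases (⟨out k, rfl⟩ : Readable F y (P.run y []) _) with ⟨b, hb⟩ | ⟨i, hi⟩ | h
  · rw [← hb]; exact fun _ ha => Or.inr (hconst b ha)
  · rw [← hi]; exact fun _ ha => Or.inl (Or.inl (hy i ha))
  · exact fun _ ha => Or.inl (Or.inr (Set.mem_biUnion (x := (out k).eval y (P.run y [])) h ha))

/-- Running a program whose inputs are available. -/
theorem Computes.slp {κ τ : Type*} (P : SLP F κ) (y : κ → R) (out : τ → Operand F κ) :
    Computes F (Set.range y) (Set.range fun k => (out k).eval y (P.run y [])) P.length := by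
  have := Computes.simulate_out (F := F) (R := R) (fun a => {a}) (ν := 1)
    (fun op u v => (Computes.op op u v).mono_left (by
      rintro _ (rfl | rfl) <;> exact Or.inl (by simp)))
    (fun a => by simp) P y (S := Set.range y) (fun i => by simp) out
  simpa [Set.iUnion_singleton_eq_range] using this

end Computes

/-! ### Arithmetic of polynomials and of matrices of polynomials -/

/-- The coefficients of `X ^ k` in `p`, for `k < n`. -/
def coeffsBelow {R : Type*} [CommRing R] (n : ℕ) (p : R[X]) : Set R := p.coeff '' Set.Iio n

/-- The coefficients of `X ^ k` in the entries of `A`, for `k < n`. -/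
def entryCoeffsBelow {R α β : Type*} [CommRing R] (n : ℕ) (A : Matrix α β R[X]) : Set R :=
  ⋃ i, ⋃ j, coeffsBelow n (A i j)

/-- Two polynomials of degree less than `n` can be multiplied with at most `c` operations. -/
def MulsBelow (F R : Type*) [Field F] [CommRing R] [Algebra F R] (n : ℕ) (c : ℝ) : Prop :=
  ∀ p q : R[X], (∀ k, n ≤ k → p.coeff k = 0) → (∀ k, n ≤ k → q.coeff k = 0) →
    Computes F (coeffsBelow n p ∪ coeffsBelow n q) (Set.range (p * q).coeff) c

section PolynomialCost

variable {F : Type*} [Field F] {R : Type*} [CommRing R] [Algebra F R]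

theorem coeff_mem_coeffsBelow {n k : ℕ} (p : R[X]) (h : k < n) : p.coeff k ∈ coeffsBelow n p :=
  ⟨k, h, rfl⟩

theorem coeffsBelow_subset_range (n : ℕ) (p : R[X]) : coeffsBelow n p ⊆ Set.range p.coeff :=
  Set.image_subset_range _ _

theorem coeffsBelow_subset_withConst {n m : ℕ} {p : R[X]} (h : ∀ k, n ≤ k → p.coeff k = 0) :
    coeffsBelow m p ⊆ withConst F (coeffsBelow n p) := by
  rintro _ ⟨k, -, rfl⟩
  by_cases hk : k < n
  · exact Or.inl ⟨k, hk, rfl⟩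
  · rw [h k (not_lt.1 hk)]; exact zero_mem_withConst

theorem range_coeff_subset_withConst {n : ℕ} {p : R[X]} (h : ∀ k, n ≤ k → p.coeff k = 0) :
    Set.range p.coeff ⊆ withConst F (coeffsBelow n p) := by
  rintro _ ⟨k, rfl⟩
  exact coeffsBelow_subset_withConst (m := k + 1) h ⟨k, Nat.lt_succ_self k, rfl⟩

theorem coeff_mul_eq_zero_of_le {n m k : ℕ} {p q : R[X]} (hp : ∀ k, n ≤ k → p.coeff k = 0)
    (hq : ∀ k, m ≤ k → q.coeff k = 0) (hk : n + m ≤ k + 1) : (p * q).coeff k = 0 := by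
  rw [coeff_mul]
  refine Finset.sum_eq_zero fun ij hij => ?_
  rw [Finset.HasAntidiagonal.mem_antidiagonal] at hij
  by_cases h : n ≤ ij.1
  · rw [hp _ h, zero_mul]
  · rw [hq ij.2 (by omega), mul_zero]

theorem coeff_mul_congr {n : ℕ} {p p' q q' : R[X]} (hp : ∀ k < n, p.coeff k = p'.coeff k)
    (hq : ∀ k < n, q.coeff k = q'.coeff k) : ∀ k < n, (p * q).coeff k = (p' * q').coeff k := by
  intro k hk
  rw [coeff_mul, coeff_mul]
  refine Finset.sum_congr rfl fun ij hij => ?_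
  rw [Finset.HasAntidiagonal.mem_antidiagonal] at hij
  rw [hp _ (by omega), hq _ (by omega)]

theorem exists_eq_add_X_pow_mul (n : ℕ) (p : R[X]) : ∃ p₀ p₁ : R[X], p = p₀ + X ^ n * p₁ ∧
    (∀ k < n, p₀.coeff k = p.coeff k) ∧ (∀ k, n ≤ k → p₀.coeff k = 0) ∧
    ∀ k, p₁.coeff k = p.coeff (k + n) := by
  set p₀ : R[X] := ∑ i ∈ Finset.range n, monomial i (p.coeff i)
  set p₁ : R[X] := ∑ i ∈ Finset.range (p.natDegree + 1), monomial i (p.coeff (i + n))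
  have h0 : ∀ k, p₀.coeff k = if k < n then p.coeff k else 0 := by
    intro k; simp [p₀, coeff_monomial]
  have h1 : ∀ k, p₁.coeff k = p.coeff (k + n) := by
    intro k
    simp only [p₁, coeff_monomial, finsetSum_coeff, Finset.sum_ite_eq', Finset.mem_range]
    split_ifs with h
    · rfl
    · exact (coeff_eq_zero_of_natDegree_lt (by omega)).symm
  refine ⟨p₀, p₁, ?_, fun k hk => by simp [h0, hk], fun k hk => by simp [h0, hk], h1⟩
  ext k
  rw [coeff_add, coeff_X_pow_mul', h0]
  by_cases h : k < n
  · simp [h]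
  · simp [h, not_lt.1 h, h1, Nat.sub_add_cancel (not_lt.1 h)]

theorem Computes.pointwise {κ : Type*} (s : Finset κ) (op : ArithOp) (a b : κ → R) :
    Computes F (a '' s ∪ b '' s) ((fun i => op.apply (a i) (b i)) '' s) s.card := by
  have := Computes.biUnion (F := F) (S := a '' s ∪ b '' s) s
    (T := fun i => {op.apply (a i) (b i)}) (c := fun _ => 1) fun i hi =>
      (Computes.op op (a i) (b i)).mono_left (by
        rintro _ (rfl | rfl)
        · exact Or.inl (Or.inl ⟨i, hi, rfl⟩)
        · exact Or.inl (Or.inr ⟨i, hi, rfl⟩))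
  refine (this.mono_cost (by simp)).mono_right ?_
  rintro _ ⟨i, hi, rfl⟩
  exact Or.inl (Set.mem_biUnion hi rfl)

theorem Computes.coeffs_add (n : ℕ) (p q : R[X]) :
    Computes F (coeffsBelow n p ∪ coeffsBelow n q) (coeffsBelow n (p + q)) n := by
  have := Computes.pointwise (F := F) (Finset.range n) .add p.coeff q.coeff
  simpa [coeffsBelow, ArithOp.apply, Finset.coe_range] using this

theorem Computes.coeffs_sub (n : ℕ) (p q : R[X]) :
    Computes F (coeffsBelow n p ∪ coeffsBelow n q) (coeffsBelow n (p - q)) n := by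
  have := Computes.pointwise (F := F) (Finset.range n) .sub p.coeff q.coeff
  simpa [coeffsBelow, ArithOp.apply, Finset.coe_range] using this

theorem MulsBelow.mono_cost {n : ℕ} {c c' : ℝ} (h : MulsBelow F R n c) (hc : c ≤ c') :
    MulsBelow F R n c' := fun p q hp hq => (h p q hp hq).mono_cost hc

theorem MulsBelow.mono {n m : ℕ} {c : ℝ} (h : MulsBelow F R n c) (hm : m ≤ n) :
    MulsBelow F R m c := fun p q hp hq =>
  (h p q (fun k hk => hp k (hm.trans hk)) (fun k hk => hq k (hm.trans hk))).mono_left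
    (Set.union_subset
      ((coeffsBelow_subset_withConst hp).trans (withConst_mono Set.subset_union_left))
      ((coeffsBelow_subset_withConst hq).trans (withConst_mono Set.subset_union_right)))

/-- Low coefficients of a product depend only on low coefficients of the factors, so both factors
can be truncated before they are multiplied. -/
theorem MulsBelow.truncated {n : ℕ} {c : ℝ} (h : MulsBelow F R n c) (p q : R[X]) :
    Computes F (coeffsBelow n p ∪ coeffsBelow n q) (coeffsBelow n (p * q)) c := by
  obtain ⟨p₀, p₁, -, hp, hp0, -⟩ := exists_eq_add_X_pow_mul n p
  obtain ⟨q₀, q₁, -, hq, hq0, -⟩ := exists_eq_add_X_pow_mul n q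
  have e1 : coeffsBelow n p₀ = coeffsBelow n p := Set.image_congr fun k hk => hp k hk
  have e2 : coeffsBelow n q₀ = coeffsBelow n q := Set.image_congr fun k hk => hq k hk
  have e3 : coeffsBelow n (p₀ * q₀) = coeffsBelow n (p * q) :=
    Set.image_congr fun k hk => coeff_mul_congr hp hq k hk
  have := h p₀ q₀ hp0 hq0
  rw [e1, e2] at this
  refine this.mono_right ?_
  rw [← e3]
  exact (coeffsBelow_subset_range _ _).trans Set.subset_union_left

theorem coeffsBelow_X_pow_mul_subset (n m : ℕ) (p : R[X]) :
    coeffsBelow n (X ^ m * p) ⊆ withConst F (coeffsBelow n p) := by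
  rintro _ ⟨k, hk, rfl⟩
  rw [coeff_X_pow_mul']
  split_ifs with h
  · exact Or.inl ⟨k - m, lt_of_le_of_lt (Nat.sub_le _ _) hk, rfl⟩
  · exact zero_mem_withConst

/-- Schoolbook splitting into halves: four products of half the length and three additions of length
`4 * n`. Superadditivity does not bound `M (2 * n)` in terms of `M n`, so constant factors in the
degree must be paid for in this way. -/
theorem MulsBelow.double {n : ℕ} {c : ℝ} (h : MulsBelow F R n c) :
    MulsBelow F R (2 * n) (4 * c + 12 * n) := by
  intro p q hp hq
  obtain ⟨p₀, p₁, ep, hp0, hp0', hp1⟩ := exists_eq_add_X_pow_mul n p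
  obtain ⟨q₀, q₁, eq, hq0, hq0', hq1⟩ := exists_eq_add_X_pow_mul n q
  have hp1' : ∀ k, n ≤ k → p₁.coeff k = 0 := fun k hk => by rw [hp1, hp _ (by omega)]
  have hq1' : ∀ k, n ≤ k → q₁.coeff k = 0 := fun k hk => by rw [hq1, hq _ (by omega)]
  set S := coeffsBelow (2 * n) p ∪ coeffsBelow (2 * n) q
  have sp0 : coeffsBelow n p₀ ⊆ S := by
    rintro _ ⟨k, hk, rfl⟩
    have hk : k < n := hk
    rw [hp0 k hk]; exact Or.inl (coeff_mem_coeffsBelow p (by omega))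
  have sq0 : coeffsBelow n q₀ ⊆ S := by
    rintro _ ⟨k, hk, rfl⟩
    have hk : k < n := hk
    rw [hq0 k hk]; exact Or.inr (coeff_mem_coeffsBelow q (by omega))
  have sp1 : coeffsBelow n p₁ ⊆ S := by
    rintro _ ⟨k, hk, rfl⟩
    have hk : k < n := hk
    rw [hp1 k]; exact Or.inl (coeff_mem_coeffsBelow p (by omega))
  have sq1 : coeffsBelow n q₁ ⊆ S := by
    rintro _ ⟨k, hk, rfl⟩
    have hk : k < n := hk
    rw [hq1 k]; exact Or.inr (coeff_mem_coeffsBelow q (by omega))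
  have key : ∀ a b : R[X], (∀ k, n ≤ k → a.coeff k = 0) → (∀ k, n ≤ k → b.coeff k = 0) →
      coeffsBelow n a ⊆ S → coeffsBelow n b ⊆ S →
        Computes F S (coeffsBelow (4 * n) (a * b)) c := fun a b ha hb sa sb =>
    ((h a b ha hb).mono_left (Set.union_subset (fun _ hx => Or.inl (sa hx))
      (fun _ hx => Or.inl (sb hx)))).mono_right
        ((coeffsBelow_subset_range _ _).trans Set.subset_union_left)
  have h1 := ((key p₀ q₀ hp0' hq0' sp0 sq0).union (key p₁ q₁ hp1' hq1' sp1 sq1)).union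
    ((key p₀ q₁ hp0' hq1' sp0 sq1).union (key p₁ q₀ hp1' hq0' sp1 sq0))
  have h2 := h1.trans ((Computes.coeffs_add (4 * n) (p₀ * q₁) (p₁ * q₀)).mono_left
    (S' := S ∪ _) (by
      refine Set.union_subset ?_ ?_
      · exact fun _ hx => Or.inl (Or.inr (Or.inr (Or.inl hx)))
      · exact fun _ hx => Or.inl (Or.inr (Or.inr (Or.inr hx)))))
  have h3 := h2.trans ((Computes.coeffs_add (4 * n) (p₀ * q₀)
    (X ^ n * (p₀ * q₁ + p₁ * q₀))).mono_left (S' := S ∪ _) (by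
      refine Set.union_subset ?_ ((coeffsBelow_X_pow_mul_subset _ _ _).trans (withConst_mono ?_))
      · exact fun _ hx => Or.inl (Or.inr (Or.inl (Or.inl (Or.inl hx))))
      · exact fun _ hx => Or.inr (Or.inr hx)))
  have h4 := h3.trans_right ((Computes.coeffs_add (4 * n)
    (p₀ * q₀ + X ^ n * (p₀ * q₁ + p₁ * q₀)) (X ^ (2 * n) * (p₁ * q₁))).mono_left (S' := S ∪ _) (by
      refine Set.union_subset ?_ ((coeffsBelow_X_pow_mul_subset _ _ _).trans (withConst_mono ?_))
      · exact fun _ hx => Or.inl (Or.inr (Or.inr hx))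
      · exact fun _ hx => Or.inr (Or.inl (Or.inl (Or.inl (Or.inr hx))))))
  have e : p₀ * q₀ + X ^ n * (p₀ * q₁ + p₁ * q₀) + X ^ (2 * n) * (p₁ * q₁) = p * q := by
    rw [ep, eq]; ring
  rw [e] at h4
  refine (h4.mono_cost (le_of_eq (by push_cast; ring))).mono_right
    (range_coeff_subset_withConst fun k hk => coeff_mul_eq_zero_of_le hp hq (by omega))

theorem entryCoeffsBelow_subset_iff {α β : Type*} {n : ℕ} {A : Matrix α β R[X]} {S : Set R} :
    entryCoeffsBelow n A ⊆ S ↔ ∀ i j, ∀ k < n, (A i j).coeff k ∈ S := by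
  simp only [entryCoeffsBelow, Set.iUnion_subset_iff, coeffsBelow, Set.image_subset_iff]
  rfl

theorem coeff_mem_entryCoeffsBelow {α β : Type*} {n k : ℕ} (A : Matrix α β R[X]) (i : α) (j : β)
    (h : k < n) : (A i j).coeff k ∈ entryCoeffsBelow n A :=
  entryCoeffsBelow_subset_iff.1 subset_rfl i j k h

theorem Computes.entryCoeffs_add {α β : Type*} [Fintype α] [Fintype β] (n : ℕ)
    (A B : Matrix α β R[X]) :
    Computes F (entryCoeffsBelow n A ∪ entryCoeffsBelow n B) (entryCoeffsBelow n (A + B))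
      (Fintype.card α * (Fintype.card β * n)) := by
  refine .iUnion fun i => .iUnion fun j => (Computes.coeffs_add n (A i j) (B i j)).mono_left ?_
  refine Set.union_subset ?_ ?_
  · rintro _ ⟨k, hk, rfl⟩
    exact Or.inl (Or.inl (coeff_mem_entryCoeffsBelow A i j hk))
  · rintro _ ⟨k, hk, rfl⟩
    exact Or.inl (Or.inr (coeff_mem_entryCoeffsBelow B i j hk))

theorem Computes.coeffs_sum_mul {κ : Type*} (s : Finset κ) {n : ℕ} {c : ℝ}
    (h : MulsBelow F R n c) (p q : κ → R[X]) {S : Set R} (hp : ∀ i ∈ s, coeffsBelow n (p i) ⊆ S)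
    (hq : ∀ i ∈ s, coeffsBelow n (q i) ⊆ S) :
    Computes F S (coeffsBelow n (∑ i ∈ s, p i * q i)) (s.card * (c + n)) := by
  classical
  induction s using Finset.induction_on with
  | empty =>
    refine .of_subset ?_ (by simp)
    rintro _ ⟨k, -, rfl⟩
    simpa using zero_mem_withConst
  | insert i s hi ih =>
    have h1 := ih (fun j hj => hp j (Finset.mem_insert_of_mem hj))
      (fun j hj => hq j (Finset.mem_insert_of_mem hj))
    have h2 := (h.truncated (p i) (q i)).mono_left (S' := S) (Set.union_subset
      (fun _ hx => Or.inl (hp i (Finset.mem_insert_self i s) hx))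
      (fun _ hx => Or.inl (hq i (Finset.mem_insert_self i s) hx)))
    have h3 := (h2.union h1).trans_right ((Computes.coeffs_add n (p i * q i) _).mono_left
      fun _ hx => Or.inl (Or.inr hx))
    rw [Finset.sum_insert hi, Finset.card_insert_of_notMem hi]
    exact h3.mono_cost (le_of_eq (by push_cast; ring))

theorem Computes.coeffs_vecMul {α β : Type*} [Fintype α] [Fintype β] {n : ℕ} {c : ℝ}
    (h : MulsBelow F R n c) (v : α → R[X]) (A : Matrix α β R[X]) :
    Computes F ((⋃ i, coeffsBelow n (v i)) ∪ entryCoeffsBelow n A)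
      (⋃ j, coeffsBelow n (Matrix.vecMul v A j))
      (Fintype.card β * (Fintype.card α * (c + n))) := by
  refine .iUnion fun j => ?_
  have := Computes.coeffs_sum_mul (F := F) Finset.univ h v (fun i => A i j)
    (S := (⋃ i, coeffsBelow n (v i)) ∪ entryCoeffsBelow n A)
    (fun i _ => (Set.subset_iUnion (fun i => coeffsBelow n (v i)) i).trans Set.subset_union_left)
    (fun i _ => by
      rintro _ ⟨k, hk, rfl⟩
      exact Or.inr (coeff_mem_entryCoeffsBelow A i j hk))
  simpa [Matrix.vecMul, dotProduct] using this

/-- Geometric sums by repeated squaring, in a ring `A` whose elements are described by sets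
`co a` of elements of `R`. -/
theorem Computes.geom_sum {A : Type*} [Ring A] (co : A → Set R) {μ α : ℝ}
    (hmul : ∀ u v : A, Computes F (co u ∪ co v) (co (u * v)) μ)
    (hadd : ∀ u v : A, Computes F (co u ∪ co v) (co (u + v)) α)
    (hone : co 1 ⊆ withConst F ∅) (u : A) (k : ℕ) :
    Computes F (co u) (co (∑ j ∈ Finset.range (2 ^ k), u ^ j) ∪ co (u ^ 2 ^ k))
      (k * (2 * μ + α)) := by
  induction k with
  | zero =>
    refine .of_subset ?_ (by simp)
    simp only [pow_zero, Finset.sum_range_one, pow_one]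
    exact Set.union_subset (hone.trans (withConst_mono (Set.empty_subset _)))
      Set.subset_union_left
  | succ k ih =>
    set s := ∑ j ∈ Finset.range (2 ^ k), u ^ j
    set w := u ^ 2 ^ k
    have e1 : ∑ j ∈ Finset.range (2 ^ (k + 1)), u ^ j = s + s * w := by
      rw [pow_succ, mul_two, Finset.sum_range_add, Finset.sum_mul]
      simp only [s, w, ← pow_add, add_comm]
    have e2 : u ^ 2 ^ (k + 1) = w * w := by rw [pow_succ, mul_two, pow_add]
    rw [e1, e2]
    have h1 := ih.trans (((hmul s w).union ((hmul w w).mono_left (by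
      rw [Set.union_self]; exact fun _ hx => Or.inl (Or.inr hx)))).mono_left
        (S' := co u ∪ (co s ∪ co w)) (fun _ hx => Or.inl (Or.inr hx)))
    have h2 := h1.trans ((hadd s (s * w)).mono_left (S' := co u ∪ _) (Set.union_subset
      (fun _ hx => Or.inl (Or.inr (Or.inl (Or.inl hx))))
      (fun _ hx => Or.inl (Or.inr (Or.inr (Or.inl hx))))))
    refine (h2.mono_cost (le_of_eq (by push_cast; ring))).mono_right (Set.union_subset ?_ ?_)
    · exact fun _ hx => Or.inl (Or.inr hx)
    · exact fun _ hx => Or.inl (Or.inl (Or.inr (Or.inr hx)))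

end PolynomialCost

/-- `n × n` matrices of polynomials are multiplied modulo `X ^ D` by running a program for matrix
multiplication with polynomials modulo `X ^ D` as the scalars. -/
theorem IsMatMulExponent.computes_mul {F : Type u} [Field F] {ω K : ℝ}
    (hF : IsMatMulExponent F ω K) {R : Type u} [CommRing R] [Algebra F R] {n : ℕ} (hn : 1 ≤ n)
    {D : ℕ} {ν : ℝ} (hmul : MulsBelow F R D ν) (hD : (D : ℝ) ≤ ν)
    (Y Z : Matrix (Fin n) (Fin n) R[X]) :
    Computes F (entryCoeffsBelow D Y ∪ entryCoeffsBelow D Z) (entryCoeffsBelow D (Y * Z))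
      (K * (n : ℝ) ^ ω * ν) := by
  obtain ⟨P, out, hP, hout⟩ := hF n hn
  have h := Computes.simulate_out (F := F) (coeffsBelow D) (ν := ν) (A := R[X]) (by
      rintro (_ | _ | _) u v
      · exact (Computes.coeffs_add D u v).mono_cost hD
      · exact (Computes.coeffs_sub D u v).mono_cost hD
      · exact hmul.truncated u v) (by
      rintro a _ ⟨k, -, rfl⟩
      rw [Polynomial.algebraMap_apply, coeff_C]
      split_ifs
      · exact ⟨a, rfl⟩
      · exact ⟨0, map_zero _⟩) P
    (Sum.elim (fun a => Y a.1 a.2) (fun a => Z a.1 a.2))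
    (S := entryCoeffsBelow D Y ∪ entryCoeffsBelow D Z) (by
      rintro (⟨i, j⟩ | ⟨i, j⟩) _ ⟨k, hk, rfl⟩
      · exact Or.inl (coeff_mem_entryCoeffsBelow Y i j hk)
      · exact Or.inr (coeff_mem_entryCoeffsBelow Z i j hk))
    (fun ij : Fin n × Fin n => out ij.1 ij.2)
  refine (h.mono_cost (mul_le_mul_of_nonneg_right hP ((Nat.cast_nonneg D).trans hD))).mono_right ?_
  rw [entryCoeffsBelow_subset_iff]
  intro i j k hk
  refine Or.inl (Set.mem_iUnion.2 ⟨(i, j), ?_⟩)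
  rw [hout R[X] Y Z i j]
  exact coeff_mem_coeffsBelow _ hk

theorem coeff_vecPoly {F : Type*} [Field F] {n : ℕ} (v : Fin n → F) (k : ℕ) :
    (vecPoly v).coeff k = if h : k < n then v ⟨k, h⟩ else 0 := by
  simp only [vecPoly, finsetSum_coeff, coeff_C_mul, coeff_X_pow]
  split_ifs with h
  · rw [Finset.sum_eq_single ⟨k, h⟩]
    · simp
    · intro i _ hi
      have : k ≠ i := fun e => hi (Fin.ext e.symm)
      simp [this]
    · simp
  · refine Finset.sum_eq_zero fun i _ => ?_
    have : k ≠ i := fun e => h (e ▸ i.2)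
    simp [this]

/-- A program that multiplies polynomials over `F` multiplies polynomials over a ring of
`F`-valued functions. -/
theorem IsPolyMulCost.mulsBelow {F : Type*} [Field F] {M : ℕ → ℝ} (hM : IsPolyMulCost F M)
    (E : Type*) (n : ℕ) : MulsBelow F (E → F) (n + 1) (M n) := by
  intro p q hp hq
  obtain ⟨P, out, hP, hout⟩ := hM n
  set x : Fin (n + 1) ⊕ Fin (n + 1) → (E → F) :=
    Sum.elim (fun i => p.coeff i) (fun i => q.coeff i)
  have hmap : ∀ (r : (E → F)[X]) (e : E), (∀ k, n + 1 ≤ k → r.coeff k = 0) →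
      r.map (Pi.evalRingHom (fun _ => F) e) = vecPoly fun i : Fin (n + 1) => r.coeff i e := by
    intro r e hr
    ext k
    rw [coeff_map, coeff_vecPoly]
    split_ifs with h
    · rfl
    · rw [hr k (not_lt.1 h)]; rfl
  refine ((Computes.slp P x out).mono_cost hP).mono ?_ ?_ le_rfl
  · rintro _ ⟨i | i, rfl⟩
    · exact Or.inl (Or.inl (coeff_mem_coeffsBelow p i.2))
    · exact Or.inl (Or.inr (coeff_mem_coeffsBelow q i.2))
  · rintro _ ⟨k, rfl⟩
    by_cases hk : k < 2 * n + 1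
    · refine Or.inl (Or.inr ⟨⟨k, hk⟩, ?_⟩)
      funext e
      have h1 := Operand.map_eval (Pi.evalAlgHom F (fun _ : E => F) e) (out ⟨k, hk⟩) x (P.run x [])
      rw [SLP.map_run] at h1
      have h2 := hout (fun i => p.coeff i e) (fun i => q.coeff i e) ⟨k, hk⟩
      rw [← hmap p e hp, ← hmap q e hq, ← Polynomial.map_mul, coeff_map] at h2
      have hx : (fun i => (Pi.evalAlgHom F (fun _ : E => F) e) (x i)) =
          Sum.elim (fun i : Fin (n + 1) => p.coeff i e)
            (fun i : Fin (n + 1) => q.coeff i e) := by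
        funext i; rcases i with i | i <;> rfl
      rw [hx] at h1
      exact h1.trans h2
    · rw [coeff_mul_eq_zero_of_le hp hq (by omega)]
      exact zero_mem_withConst

/-! ### Lower bounds for the costs of polynomial and of matrix multiplication -/

/-- Without operations an output is a constant or a single input, and neither equals the product of
the two constant coefficients. -/
theorem IsPolyMulCost.one_le {F : Type*} [Field F] {M : ℕ → ℝ} (hM : IsPolyMulCost F M) (n : ℕ) :
    1 ≤ M n := by
  obtain ⟨P, out, hP, hout⟩ := hM n
  refine le_trans ?_ hP
  by_contra hlt
  have hnil : P = [] := by
    rw [not_le, Nat.cast_lt_one] at hlt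
    exact List.length_eq_zero_iff.1 hlt
  subst hnil
  have hout0 : ∀ p q : Fin (n + 1) → F,
      (out 0).eval (Sum.elim p q) [] = p 0 * q 0 := by
    intro p q
    have := hout p q 0
    rw [SLP.run_nil] at this
    rw [this]
    simp [mul_coeff_zero, coeff_vecPoly]
  rcases h : out 0 with a | (i | i) | k <;> rw [h] at hout0 <;> simp only [Operand.eval] at hout0
  · have h0 := hout0 0 0
    have h1 := hout0 1 1
    rw [h0] at h1; simp at h1
  · have := hout0 1 0; simp at this
  · have := hout0 0 1; simp at this
  · have := hout0 1 1; simp at this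

/-- The `n ^ 2` entries of the product need `n ^ 2` different registers. The bound lets matrix
additions be charged to a matrix multiplication, and for `n = 1` it gives `1 ≤ K`. -/
theorem IsMatMulExponent.sq_le {F : Type u} [Field F] {ω K : ℝ} (hF : IsMatMulExponent F ω K)
    {n : ℕ} (hn : 1 ≤ n) : (n : ℝ) ^ 2 ≤ K * (n : ℝ) ^ ω := by
  obtain ⟨P, out, hP, hout⟩ := hF n hn
  refine le_trans ?_ hP
  replace hout := hout F
  -- An entry of the product is neither a constant nor an input, and it is not always the default
  -- `0` of a reference beyond memory, so it comes from an instruction.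
  have hreg : ∀ i j, ∃ k : Fin P.length, out i j = .reg k := by
    intro i j
    have h1 := hout 1 (Matrix.single i j 1) i j
    rw [one_mul, Matrix.single_apply_same] at h1
    rcases h : out i j with a | (a | a) | k
    · have h0 := hout 0 0 i j
      rw [h] at h0 h1
      simp only [Operand.eval, zero_mul, Matrix.zero_apply] at h0 h1
      rw [h0] at h1
      exact absurd h1 zero_ne_one
    · have h0 := hout (Matrix.of fun _ _ => 1) 0 i j
      rw [h, mul_zero] at h0
      simp [Operand.eval] at h0
    · have h0 := hout 0 (Matrix.of fun _ _ => 1) i j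
      rw [h, zero_mul] at h0
      simp [Operand.eval] at h0
    · refine ⟨⟨k, ?_⟩, rfl⟩
      by_contra hk
      rw [h] at h1
      simp only [Operand.eval] at h1
      rw [List.getD_eq_default _ _ (by rw [SLP.length_run]; simpa using hk)] at h1
      exact zero_ne_one h1
  choose r hr using hreg
  -- Multiplying the identity by a matrix unit separates the entry at its position from all others.
  have hinj : Function.Injective fun ij : Fin n × Fin n => r ij.1 ij.2 := by
    rintro ⟨i, j⟩ ⟨i', j'⟩ h
    simp only at h
    have h1 := hout 1 (Matrix.single i j 1) i j
    have h2 := hout 1 (Matrix.single i j 1) i' j'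
    rw [hr, h, ← hr, h2, one_mul, Matrix.single_apply_same, Matrix.single_apply] at h1
    by_contra hne
    rw [if_neg (fun h => hne (Prod.ext h.1 h.2))] at h1
    exact zero_ne_one h1
  have := Fintype.card_le_of_injective _ hinj
  simp only [Fintype.card_prod, Fintype.card_fin] at this
  rw [sq]
  exact_mod_cast this

/-- A negative `ω` would give `n ^ 2 ≤ K` for every `n ≥ 1`. Nonnegativity is what allows `(T + 1) ^
ω` to be bounded by `(2 * t) ^ ω`. -/
theorem IsMatMulExponent.exponent_nonneg {F : Type u} [Field F] {ω K : ℝ}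
    (hF : IsMatMulExponent F ω K) : 0 ≤ ω := by
  by_contra hω
  have hK : 1 ≤ K := by simpa using hF.sq_le le_rfl
  obtain ⟨n, hn⟩ := exists_nat_gt K
  have hn1 : (1 : ℝ) ≤ n := hK.trans hn.le
  have h1 := hF.sq_le (Nat.one_le_cast.1 hn1)
  have h2 : (n : ℝ) ^ ω ≤ 1 := Real.rpow_le_one_of_one_le_of_nonpos hn1 (not_le.1 hω).le
  nlinarith

section Superadditive

variable {M : ℕ → ℝ} (hM : ∀ a b : ℕ, 1 ≤ a → 1 ≤ b → M a + M b ≤ M (a + b))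
include hM

theorem mul_le_of_superadditive {a b : ℕ} (ha : 1 ≤ a) (hb : 1 ≤ b) : a * M b ≤ M (a * b) := by
  induction a, ha using Nat.le_induction with
  | base => simp
  | succ a ha ih =>
    have := hM (a * b) b (Nat.mul_pos ha hb) hb
    rw [Nat.succ_mul]
    push_cast
    linarith

theorem mono_of_superadditive (h1 : ∀ n, 1 ≤ M n) {a b : ℕ} (ha : 1 ≤ a) (hab : a ≤ b) :
    M a ≤ M b := by
  obtain rfl | hlt := hab.eq_or_lt
  · exact le_rfl
  · have := hM a (b - a) ha (by omega)
    rw [Nat.add_sub_cancel' hab] at this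
    linarith [h1 (b - a)]

/-- Follows from `n * M 1 ≤ M n`. It absorbs linear numbers of additions into the cost of a
multiplication. -/
theorem self_le_of_superadditive (h1 : ∀ n, 1 ≤ M n) {n : ℕ} (hn : 1 ≤ n) : (n : ℝ) ≤ M n := by
  have := mul_le_of_superadditive hM hn le_rfl
  rw [mul_one] at this
  nlinarith [h1 1, (Nat.one_le_cast (α := ℝ)).2 hn]

end Superadditive

/-- Three doublings cost `64 * c + 336 * L`. -/
theorem MulsBelow.eight_mul {F R : Type*} [Field F] [CommRing R] [Algebra F R] {L : ℕ} {c : ℝ}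
    (h : MulsBelow F R L c) (hL : (L : ℝ) ≤ c) : MulsBelow F R (8 * L) (400 * c) := by
  have := h.double.double.double
  rw [← mul_assoc, ← mul_assoc] at this
  refine this.mono_cost ?_
  push_cast
  linarith

/-! ### Linear recurrences and products of their block transition matrices -/

/-- The solution of `y i = ∑_{1 ≤ j ≤ T} g i j * y (i - j) + c i`, with `T` leading zeros:
the value at `T + i` is `y i`. -/
noncomputable def recSol {A : Type*} [CommRing A] (T : ℕ) (g : ℕ → ℕ → A) (c : ℕ → A) (n : ℕ) : A :=
  if _h : n < T then 0
  else ∑ j : Fin T, g (n - T) (j + 1) * recSol T g c (n - (j + 1)) + c (n - T)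
termination_by n
decreasing_by have := j.2; omega

section Recurrence

variable {A : Type*} [CommRing A] {T : ℕ} {g : ℕ → ℕ → A} {c : ℕ → A}

theorem recSol_of_lt {n : ℕ} (h : n < T) : recSol T g c n = 0 := by
  rw [recSol, dif_pos h]

theorem recSol_add (i : ℕ) : recSol T g c (T + i) =
    ∑ j ∈ Finset.range T, g i (j + 1) * recSol T g c (T + i - (j + 1)) + c i := by
  rw [recSol, dif_neg (by omega), Nat.add_sub_cancel_left, Finset.sum_range]

/-- The coefficients inside a block of `T` consecutive equations; index `0` stands for the
constant `1`. -/
def blockLower (T : ℕ) (g : ℕ → ℕ → A) (c : ℕ → A) (I : ℕ) :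
    Matrix (Fin (T + 1)) (Fin (T + 1)) A :=
  Matrix.of fun p q => Fin.cases (motive := fun _ => A) 0
    (fun a => Fin.cases (motive := fun _ => A) (c (I * T + a))
      (fun b => if (b : ℕ) < a then g (I * T + a) (a - b) else 0) q) p

/-- The coefficients of the values of the previous block in a block of `T` consecutive
equations. -/
def blockUpper (T : ℕ) (g : ℕ → ℕ → A) (I : ℕ) : Matrix (Fin (T + 1)) (Fin (T + 1)) A :=
  Matrix.of fun p q => Fin.cases (motive := fun _ => A)
    (Fin.cases (motive := fun _ => A) 1 (fun _ => 0) q)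
    (fun a => Fin.cases (motive := fun _ => A) 0
      (fun b => if (a : ℕ) ≤ b then g (I * T + a) (T + a - b) else 0) q) p

/-- The constant `1`, followed by the `I`-th block of `T` values of `y`. -/
def blockState (T : ℕ) (y : ℕ → A) (I : ℕ) : Fin (T + 1) → A :=
  Fin.cons 1 fun a : Fin T => y (I * T + a)

theorem blockState_succ (I : ℕ) : blockState T (recSol T g c) (I + 1) =
    (blockLower T g c I).mulVec (blockState T (recSol T g c) (I + 1)) +
      (blockUpper T g I).mulVec (blockState T (recSol T g c) I) := by
  funext p
  refine Fin.cases ?_ (fun a => ?_) p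
  · simp [blockState, blockLower, blockUpper, Matrix.mulVec, dotProduct, Fin.sum_univ_succ]
  · have ha := a.2
    simp only [blockState, blockLower, blockUpper, Matrix.mulVec, dotProduct, Fin.sum_univ_succ,
      Pi.add_apply, Matrix.of_apply, Fin.cases_succ, Fin.cases_zero, Fin.cons_zero, Fin.cons_succ,
      mul_one, zero_mul, zero_add, ite_mul]
    rw [show (I + 1) * T + (a : ℕ) = T + (I * T + a) by ring, recSol_add, add_comm, add_assoc,
      ← Finset.sum_add_distrib]
    congr 1
    rw [← Fin.sum_univ_eq_sum_range fun j => g (I * T + a) (j + 1) *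
      recSol T g c (T + (I * T + a) - (j + 1))]
    -- This involution exchanges a column `j` of the block with the offset (less one) at which its
    -- value enters equation `a`: the offset is `a - j` in the current block if `j < a`, and `T + a
    -- - j` in the previous block otherwise.
    have hσ : ∀ j : Fin T, (if (j : ℕ) < a then (a : ℕ) - j - 1 else T + a - j - 1) < T := by
      intro j
      have := j.2
      split_ifs <;> omega
    have hσσ : ∀ j : Fin T, (⟨_, hσ ⟨_, hσ j⟩⟩ : Fin T) = j := by
      intro j
      have := j.2
      ext
      simp only
      split_ifs <;> omega
    symm
    refine Finset.sum_bij' (fun j _ => ⟨_, hσ j⟩) (fun j _ => ⟨_, hσ j⟩) (by simp) (by simp)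
      (fun j _ => hσσ j) (fun j _ => hσσ j) ?_
    intro j _
    have := j.2
    by_cases h : (j : ℕ) < a
    · have e1 : (a : ℕ) - j - 1 + 1 = a - j := by omega
      have e2 : T + (I * T + (a : ℕ)) - (a - j) = (I + 1) * T + j := by
        rw [add_mul]; omega
      simp only [h, not_le.2 h, if_true, if_false, add_zero, e1, e2]
    · have e1 : T + (a : ℕ) - j - 1 + 1 = T + a - j := by omega
      have e2 : T + (I * T + (a : ℕ)) - (T + a - j) = I * T + j := by omega
      simp only [h, not_lt.1 h, if_true, if_false, zero_add, e1, e2]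

theorem pow_apply_eq_zero_of_strictlyLower {n : ℕ} {G : Matrix (Fin n) (Fin n) A}
    (hG : ∀ p q, p ≤ q → G p q = 0) (k : ℕ) :
    ∀ p q : Fin n, (p : ℕ) < q + k → (G ^ k) p q = 0 := by
  induction k with
  | zero =>
    intro p q h
    rw [pow_zero, Matrix.one_apply_ne (by rintro rfl; omega)]
  | succ k ih =>
    intro p q h
    rw [pow_succ, Matrix.mul_apply]
    refine Finset.sum_eq_zero fun r _ => ?_
    by_cases hr : (p : ℕ) < r + k
    · rw [ih p r hr, zero_mul]
    · rw [hG r q (by rw [Fin.le_def]; omega), mul_zero]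

theorem blockLower_pow_eq_zero (I : ℕ) {k : ℕ} (hk : T + 1 ≤ k) :
    blockLower T g c I ^ k = 0 := by
  ext p q
  refine pow_apply_eq_zero_of_strictlyLower ?_ k p q (by omega)
  intro p q
  refine Fin.cases ?_ (fun a => ?_) p
  · simp [blockLower]
  · refine Fin.cases ?_ (fun b => ?_) q
    · exact fun h => absurd (Fin.le_zero_iff.1 h) (Fin.succ_ne_zero a)
    · intro h
      have h : ¬ (b : ℕ) < a := not_lt.2 (Fin.succ_le_succ_iff.1 h)
      simp only [blockLower, Matrix.of_apply, Fin.cases_succ, if_neg h]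

/-- The transition matrix from one block to the next; `2 ^ r` bounds the block size. -/
def blockTransition (T : ℕ) (g : ℕ → ℕ → A) (c : ℕ → A) (r I : ℕ) :
    Matrix (Fin (T + 1)) (Fin (T + 1)) A :=
  (∑ j ∈ Finset.range (2 ^ r), blockLower T g c I ^ j) * blockUpper T g I

theorem blockTransition_mulVec {r : ℕ} (hr : T + 1 ≤ 2 ^ r) (I : ℕ) :
    (blockTransition T g c r I).mulVec (blockState T (recSol T g c) I) =
      blockState T (recSol T g c) (I + 1) := by
  set z := blockState T (recSol T g c)
  have h1 : (blockUpper T g I).mulVec (z I) = (1 - blockLower T g c I).mulVec (z (I + 1)) := by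
    rw [Matrix.sub_mulVec, Matrix.one_mulVec]
    exact (sub_eq_of_eq_add' (blockState_succ I)).symm
  rw [blockTransition, ← Matrix.mulVec_mulVec, h1, Matrix.mulVec_mulVec, geom_sum_mul_neg,
    blockLower_pow_eq_zero I hr, sub_zero, Matrix.one_mulVec]

/-- Products of `2 ^ l` consecutive matrices of a sequence. -/
def prodTree {n : ℕ} (S : ℕ → Matrix (Fin n) (Fin n) A) : ℕ → ℕ → Matrix (Fin n) (Fin n) A
  | 0, k => S k
  | l + 1, k => prodTree S l (2 * k + 1) * prodTree S l (2 * k)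

/-- The row vectors that express sums of `2 ^ l` consecutive values by the state in front of
them. -/
def rowTree {n : ℕ} (S : ℕ → Matrix (Fin n) (Fin n) A) (v : ℕ → Fin n → A) : ℕ → ℕ → Fin n → A
  | 0, k => v k
  | l + 1, k => rowTree S v l (2 * k) +
      Matrix.vecMul (rowTree S v l (2 * k + 1)) (prodTree S l (2 * k))

section Tree

variable {n : ℕ} {S : ℕ → Matrix (Fin n) (Fin n) A} {z : ℕ → Fin n → A}

theorem prodTree_mulVec (hz : ∀ I, (S I).mulVec (z I) = z (I + 1)) (l k : ℕ) :
    (prodTree S l k).mulVec (z (k * 2 ^ l)) = z ((k + 1) * 2 ^ l) := by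
  induction l generalizing k with
  | zero => simpa [prodTree] using hz k
  | succ l ih =>
    rw [prodTree, ← Matrix.mulVec_mulVec, show k * 2 ^ (l + 1) = 2 * k * 2 ^ l by ring, ih, ih]
    congr 1
    ring

/-- The row of the right half refers to the state in the middle; the product over the left half
carries it back to the front. -/
theorem rowTree_dotProduct (hz : ∀ I, (S I).mulVec (z I) = z (I + 1)) (v : ℕ → Fin n → A)
    (l k : ℕ) : rowTree S v l k ⬝ᵥ z (k * 2 ^ l) =
      ∑ I ∈ Finset.range (2 ^ l), v (k * 2 ^ l + I) ⬝ᵥ z (k * 2 ^ l + I) := by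
  induction l generalizing k with
  | zero => simp [rowTree]
  | succ l ih =>
    rw [rowTree, add_dotProduct, ← Matrix.dotProduct_mulVec,
      show k * 2 ^ (l + 1) = 2 * k * 2 ^ l by ring, prodTree_mulVec hz, ih, ih,
      pow_succ, mul_two, Finset.sum_range_add]
    simp only [add_mul, one_mul, add_assoc]

end Tree

/-- The coefficients with which the `I`-th block of `T` values enters a linear combination. -/
def blockWeights (T : ℕ) (b : ℕ → A) (I : ℕ) : Fin (T + 1) → A :=
  Fin.cons 0 fun a : Fin T => b (I * T + a)

theorem sum_blockWeights (T : ℕ) (b y : ℕ → A) (n : ℕ) :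
    ∑ I ∈ Finset.range n, blockWeights T b I ⬝ᵥ blockState T y (I + 1) =
      ∑ i ∈ Finset.range (n * T), b i * y (T + i) := by
  induction n with
  | zero => simp
  | succ n ih =>
    rw [Finset.sum_range_succ, ih, Nat.succ_mul, Finset.sum_range_add]
    congr 1
    rw [Finset.sum_range]
    simp only [dotProduct, Fin.sum_univ_succ, blockWeights, blockState, Fin.cons_zero,
      Fin.cons_succ, zero_mul, zero_add]
    refine Finset.sum_congr rfl fun a _ => ?_
    congr 2
    ring

/-- The initial state is `(1, 0, …, 0)`, because the recurrence starts with `T` zeros. So a single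
entry of the root row is the whole linear combination. -/
theorem rowTree_zero_eq_sum {r : ℕ} (hr : T + 1 ≤ 2 ^ r) (b : ℕ → A) (l : ℕ) :
    rowTree (blockTransition T g c r)
      (fun I => Matrix.vecMul (blockWeights T b I) (blockTransition T g c r I)) l 0 0 =
      ∑ i ∈ Finset.range (2 ^ l * T), b i * recSol T g c (T + i) := by
  have h := rowTree_dotProduct (fun I => blockTransition_mulVec (g := g) (c := c) hr I)
    (fun I => Matrix.vecMul (blockWeights T b I) (blockTransition T g c r I)) l 0
  simp only [zero_mul, zero_add, ← Matrix.dotProduct_mulVec, blockTransition_mulVec hr,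
    sum_blockWeights] at h
  rw [← h, dotProduct, Fin.sum_univ_succ, Finset.sum_eq_zero, add_zero]
  · simp [blockState]
  · intro a _
    rw [blockState, Fin.cons_succ, recSol_of_lt (by have := a.2; omega), mul_zero]

end Recurrence

/-! ### Degrees -/

/-- The entry with index `(p, q)` has degree at most `e + p - q`. -/
def WeightedDegreeLE {R : Type*} [CommRing R] {n : ℕ} (e : ℕ)
    (A : Matrix (Fin n) (Fin n) R[X]) : Prop :=
  ∀ (p q : Fin n) (k : ℕ), e + p < k + q → (A p q).coeff k = 0

section Degree

variable {R : Type*} [CommRing R] {n : ℕ}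

theorem coeff_sum_mul_eq_zero {κ : Type*} (s : Finset κ) {p q : κ → R[X]} {k : ℕ}
    (h : ∀ r ∈ s, ∀ i j, i + j = k → (p r).coeff i = 0 ∨ (q r).coeff j = 0) :
    (∑ r ∈ s, p r * q r).coeff k = 0 := by
  rw [finsetSum_coeff]
  refine Finset.sum_eq_zero fun r hr => ?_
  rw [coeff_mul]
  refine Finset.sum_eq_zero fun ij hij => ?_
  rw [Finset.HasAntidiagonal.mem_antidiagonal] at hij
  rcases h r hr _ _ hij with h | h <;> simp [h]

theorem WeightedDegreeLE.one : WeightedDegreeLE 0 (1 : Matrix (Fin n) (Fin n) R[X]) := by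
  intro p q k h
  rw [Matrix.one_apply]
  split_ifs with hpq
  · subst hpq
    rw [coeff_one, if_neg (by omega)]
  · simp

/-- The inner index cancels in `(e + p - r) + (e' + r - q)`. In particular powers of a matrix of
weight `0` keep weight `0`, so inverting `1 - L` does not raise the degrees. -/
theorem WeightedDegreeLE.mul {e e' : ℕ} {A B : Matrix (Fin n) (Fin n) R[X]}
    (hA : WeightedDegreeLE e A) (hB : WeightedDegreeLE e' B) :
    WeightedDegreeLE (e + e') (A * B) := by
  intro p q k h
  rw [Matrix.mul_apply]
  refine coeff_sum_mul_eq_zero _ fun r _ i j hij => ?_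
  by_cases hi : e + p < i + r
  · exact Or.inl (hA p r i hi)
  · exact Or.inr (hB r q j (by omega))

theorem WeightedDegreeLE.sum_pow {A : Matrix (Fin n) (Fin n) R[X]}
    (hA : WeightedDegreeLE 0 A) (m : ℕ) :
    WeightedDegreeLE 0 (∑ j ∈ Finset.range m, A ^ j) := by
  have hpow : ∀ j, WeightedDegreeLE 0 (A ^ j) := by
    intro j
    induction j with
    | zero => rw [pow_zero]; exact .one
    | succ j ih => rw [pow_succ]; exact ih.mul hA
  intro p q k h
  rw [Matrix.sum_apply, finsetSum_coeff]
  exact Finset.sum_eq_zero fun j _ => hpow j p q k h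

theorem WeightedDegreeLE.prodTree {e : ℕ} {S : ℕ → Matrix (Fin n) (Fin n) R[X]}
    (hS : ∀ I, WeightedDegreeLE e (S I)) (l k : ℕ) :
    WeightedDegreeLE (2 ^ l * e) (prodTree S l k) := by
  induction l generalizing k with
  | zero => simpa [_root_.prodTree] using hS k
  | succ l ih =>
    rw [_root_.prodTree, show 2 ^ (l + 1) * e = 2 ^ l * e + 2 ^ l * e by ring]
    exact (ih _).mul (ih _)

theorem coeff_vecMul_eq_zero {e e' w : ℕ} {v : Fin n → R[X]} {A : Matrix (Fin n) (Fin n) R[X]}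
    (hv : ∀ (q : Fin n) (k : ℕ), e + w < k + q → (v q).coeff k = 0) (hA : WeightedDegreeLE e' A) (q : Fin n)
    (k : ℕ) (h : e + e' + w < k + q) : (Matrix.vecMul v A q).coeff k = 0 := by
  rw [Matrix.vecMul, dotProduct]
  refine coeff_sum_mul_eq_zero _ fun r _ i j hij => ?_
  by_cases hi : e + w < i + r
  · exact Or.inl (hv r i hi)
  · exact Or.inr (hA r q j (by omega))

theorem coeff_rowTree_eq_zero {e w : ℕ} {S : ℕ → Matrix (Fin n) (Fin n) R[X]}
    {v : ℕ → Fin n → R[X]} (hS : ∀ I, WeightedDegreeLE e (S I))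
    (hv : ∀ (I : ℕ) (q : Fin n) (k : ℕ), e + w < k + q → (v I q).coeff k = 0) (l : ℕ) :
    ∀ (I : ℕ) (q : Fin n) (k : ℕ), 2 ^ l * e + w < k + q → (rowTree S v l I q).coeff k = 0 := by
  induction l with
  | zero => simpa [rowTree] using hv
  | succ l ih =>
    intro I q k h
    rw [show 2 ^ (l + 1) * e = 2 ^ l * e + 2 ^ l * e by ring] at h
    rw [rowTree, Pi.add_apply, coeff_add, ih _ q k (by omega), zero_add]
    exact coeff_vecMul_eq_zero (ih _) (WeightedDegreeLE.prodTree hS l _) q k h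

variable {T : ℕ} {g : ℕ → ℕ → R[X]} {c : ℕ → R}

theorem weightedDegreeLE_blockTransition
    (hg : ∀ i j k, 1 ≤ j → j ≤ T → j < k → (g i j).coeff k = 0) (r I : ℕ) :
    WeightedDegreeLE T (blockTransition T g (fun i => C (c i)) r I) := by
  have h1 : WeightedDegreeLE 0 (blockLower T g (fun i => C (c i)) I) := by
    intro p q k
    refine Fin.cases ?_ (fun a => ?_) p
    · simp [blockLower]
    · refine Fin.cases ?_ (fun b => ?_) q
      · intro h
        simp only [blockLower, Matrix.of_apply, Fin.cases_succ, Fin.cases_zero, coeff_C]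
        rw [if_neg (by simp at h; omega)]
      · intro h
        simp only [blockLower, Matrix.of_apply, Fin.cases_succ]
        simp only [Fin.val_succ] at h
        have := a.2
        split_ifs
        · exact hg _ _ _ (by omega) (by omega) (by omega)
        · simp
  have h2 : WeightedDegreeLE T (blockUpper T g I) := by
    intro p q k
    refine Fin.cases ?_ (fun a => ?_) p
    · refine Fin.cases ?_ (fun b => ?_) q
      · intro h
        simp only [blockUpper, Matrix.of_apply, Fin.cases_zero, coeff_one]
        rw [if_neg (by simp at h; omega)]
      · simp [blockUpper]
    · refine Fin.cases ?_ (fun b => ?_) q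
      · simp [blockUpper]
      · intro h
        simp only [blockUpper, Matrix.of_apply, Fin.cases_succ]
        simp only [Fin.val_succ] at h
        have := b.2
        split_ifs
        · exact hg _ _ _ (by omega) (by omega) (by omega)
        · simp
  have := (h1.sum_pow (2 ^ r)).mul h2
  rwa [zero_add] at this

theorem coeff_recSol_eq_zero (hg : ∀ i j k, 1 ≤ j → j ≤ T → j < k → (g i j).coeff k = 0) :
    ∀ n k : ℕ, n < k + T → (recSol T g (fun i => C (c i)) n).coeff k = 0 := by
  intro n
  induction n using Nat.strong_induction_on with
  | _ n ih =>
    intro k hk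
    by_cases hn : n < T
    · rw [recSol_of_lt hn, coeff_zero]
    · obtain ⟨i, rfl⟩ := Nat.exists_eq_add_of_le (not_lt.1 hn)
      rw [recSol_add, coeff_add, coeff_C, if_neg (by omega), add_zero]
      refine coeff_sum_mul_eq_zero _ fun j hj a b hab => ?_
      rw [Finset.mem_range] at hj
      by_cases ha : j + 1 < a
      · exact Or.inl (hg _ _ _ (by omega) (by omega) ha)
      · exact Or.inr (ih _ (by omega) b (by omega))

end Degree

/-! ### Division with remainder -/

/-- A truncated power series inverse of the reversal of `X ^ N - m`. -/
noncomputable def reversalInverse {R : Type*} [CommRing R] (N r : ℕ) (m : R[X]) : R[X] :=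
  ∑ j ∈ Finset.range (2 ^ r), (X * reflect (N - 1) m) ^ j

section Division

variable {F : Type*} [Field F] {R : Type*} [CommRing R] [Algebra F R] {N : ℕ} {m : R[X]}

theorem degree_lt_of_coeff_eq_zero {p : R[X]} {n : ℕ} (h : ∀ k, n ≤ k → p.coeff k = 0) :
    p.degree < n :=
  (degree_lt_iff_coeff_zero p n).2 h

theorem reflect_X_pow_sub (hN : 1 ≤ N) (hm : ∀ k, N ≤ k → m.coeff k = 0) :
    reflect N (X ^ N - m) = 1 - X * reflect (N - 1) m := by
  ext i
  rw [coeff_reflect, coeff_sub, coeff_sub]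
  rcases i with _ | i
  · rw [revAt_le (Nat.zero_le N), Nat.sub_zero, coeff_X_pow_self, hm N le_rfl]
    simp
  · rw [coeff_X_mul, coeff_reflect, coeff_one, if_neg (Nat.succ_ne_zero i), coeff_X_pow]
    by_cases hi : i + 1 ≤ N
    · rw [revAt_le hi, revAt_le (by omega), if_neg (by omega)]
      congr 2
      omega
    · rw [revAt_eq_self_of_lt (by omega), if_neg (by omega)]
      by_cases h1 : i = N - 1
      · omega
      · rw [revAt_eq_self_of_lt (by omega), hm _ (by omega), hm _ (by omega)]

/-- Reversing `p = (X ^ N - m) * q + s` at length `2 * N - 1` turns `s` into a multiple of `X ^ N`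
and the modulus into `1 - u` with `X ∣ u`. Modulo `X ^ N`, multiplication by the geometric series in
`u` therefore leaves the reversed quotient. -/
theorem coeff_reversalInverse_mul [Nontrivial R] (hN : 1 ≤ N)
    (hm : ∀ k, N ≤ k → m.coeff k = 0) {r : ℕ} (hr : N ≤ 2 ^ r) {p : R[X]}
    (hp : ∀ k, 2 * N ≤ k → p.coeff k = 0) {k : ℕ} (hk : k < N) :
    (reversalInverse N r m * reflect (2 * N - 1) p).coeff k =
      (p /ₘ (X ^ N - m)).coeff (N - 1 - k) := by
  have hmon : (X ^ N - m).Monic := monic_X_pow_sub (degree_lt_of_coeff_eq_zero hm)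
  have hdeg : (X ^ N - m).natDegree = N := by
    refine natDegree_eq_of_degree_eq_some ?_
    rw [degree_sub_eq_left_of_degree_lt
      (by rw [degree_X_pow]; exact degree_lt_of_coeff_eq_zero hm), degree_X_pow]
  have hpn : p.natDegree ≤ 2 * N - 1 := by
    rw [natDegree_le_iff_coeff_eq_zero]
    exact fun k hk => hp k (by omega)
  set q := p /ₘ (X ^ N - m)
  set s := p %ₘ (X ^ N - m)
  have hq : q.natDegree ≤ N - 1 := by
    rw [natDegree_divByMonic p hmon, hdeg]; omega
  have hs : ∀ j, N ≤ j → s.coeff j = 0 := by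
    intro j hj
    refine coeff_eq_zero_of_degree_lt (lt_of_lt_of_le (degree_modByMonic_lt p hmon) ?_)
    rw [degree_eq_natDegree hmon.ne_zero, hdeg]
    exact_mod_cast hj
  have e : reflect (2 * N - 1) p = reflect (2 * N - 1) s +
      (1 - X * reflect (N - 1) m) * reflect (N - 1) q := by
    rw [← reflect_X_pow_sub hN hm, ← reflect_mul _ _ hdeg.le hq,
      show N + (N - 1) = 2 * N - 1 by omega, ← reflect_add, modByMonic_add_div]
  have e2 : reversalInverse N r m * ((1 - X * reflect (N - 1) m) * reflect (N - 1) q) =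
      reflect (N - 1) q - X ^ 2 ^ r * (reflect (N - 1) m ^ 2 ^ r * reflect (N - 1) q) := by
    rw [← mul_assoc, reversalInverse, geom_sum_mul_neg, mul_pow]
    ring
  have e3 : (reversalInverse N r m * reflect (2 * N - 1) s).coeff k = 0 := by
    rw [coeff_mul]
    refine Finset.sum_eq_zero fun ij hij => ?_
    rw [Finset.HasAntidiagonal.mem_antidiagonal] at hij
    rw [coeff_reflect, revAt_le (by omega), hs _ (by omega), mul_zero]
  rw [e, mul_add, e2, coeff_add, e3, zero_add, coeff_sub, coeff_X_pow_mul', if_neg (by omega),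
    sub_zero, coeff_reflect, revAt_le (by omega)]

theorem Computes.reversalInverse {c : ℝ} (h : MulsBelow F R N c) (r : ℕ) (hN : 1 ≤ N) :
    Computes F (coeffsBelow N m) (coeffsBelow N (reversalInverse N r m)) (r * (2 * c + N)) := by
  have := Computes.geom_sum (F := F) (coeffsBelow N) (fun u v => h.truncated u v)
    (fun u v => Computes.coeffs_add N u v) (by
      rintro _ ⟨k, -, rfl⟩
      rw [coeff_one]
      split_ifs
      · exact one_mem_withConst
      · exact zero_mem_withConst) (X * reflect (N - 1) m) r
  refine (this.mono_right fun _ hx => Or.inl (Or.inl hx)).mono_left ?_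
  rintro _ ⟨k, hk, rfl⟩
  have hk : k < N := hk
  rcases k with _ | k
  · rw [coeff_X_mul_zero]; exact zero_mem_withConst
  · rw [coeff_X_mul, coeff_reflect, revAt_le (by omega)]
    exact Or.inl (coeff_mem_coeffsBelow m (by omega))

theorem Computes.modByMonic [Nontrivial R] {c : ℝ} (h : MulsBelow F R N c) (hN : 1 ≤ N)
    (hm : ∀ k, N ≤ k → m.coeff k = 0) {r : ℕ} (hr : N ≤ 2 ^ r) {p : R[X]}
    (hp : ∀ k, 2 * N ≤ k → p.coeff k = 0) :
    Computes F (Set.range p.coeff ∪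
        (coeffsBelow N m ∪ coeffsBelow N (_root_.reversalInverse N r m)))
      (Set.range (p %ₘ (X ^ N - m)).coeff) (2 * c + N) := by
  have hmon : (X ^ N - m).Monic := monic_X_pow_sub (degree_lt_of_coeff_eq_zero hm)
  set V := _root_.reversalInverse N r m
  set S := Set.range p.coeff ∪ (coeffsBelow N m ∪ coeffsBelow N V)
  set q := p /ₘ (X ^ N - m)
  have h1 : Computes F S (coeffsBelow N q) c := by
    refine ((h.truncated V (reflect (2 * N - 1) p)).mono_left (S' := S)
      (Set.union_subset (fun _ hx => Or.inl (Or.inr (Or.inr hx))) ?_)).mono_right ?_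
    · rintro _ ⟨k, -, rfl⟩
      rw [coeff_reflect]
      exact Or.inl (Or.inl ⟨_, rfl⟩)
    · rintro _ ⟨k, hk, rfl⟩
      have hk : k < N := hk
      have := coeff_reversalInverse_mul hN hm hr hp (k := N - 1 - k) (by omega)
      rw [show N - 1 - (N - 1 - k) = k by omega] at this
      exact Or.inl ⟨N - 1 - k, show N - 1 - k < N by omega, this⟩
  have h2 := h1.trans_right ((h.truncated m q).mono_left (S' := S ∪ coeffsBelow N q)
    (Set.union_subset (fun _ hx => Or.inl (Or.inl (Or.inr (Or.inl hx))))
      (fun _ hx => Or.inl (Or.inr hx))))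
  -- Below `X ^ N` the remainder `p - (X ^ N - m) * q` agrees with `p + m * q`.
  have h3 := h2.trans_right ((Computes.coeffs_add N p (m * q)).mono_left (S' := S ∪ _)
    (Set.union_subset (fun _ hx => Or.inl (Or.inl (Or.inl (coeffsBelow_subset_range _ _ hx))))
      (fun _ hx => Or.inl (Or.inr hx))))
  refine (h3.mono_cost (by linarith)).mono_right ?_
  rintro _ ⟨k, rfl⟩
  by_cases hk : k < N
  · refine Or.inl ⟨k, hk, ?_⟩
    have e := congrArg (fun a => coeff a k) (modByMonic_add_div p (X ^ N - m))
    simp only [coeff_add, sub_mul, coeff_sub, coeff_X_pow_mul', if_neg (not_le.2 hk)] at e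
    rw [coeff_add, ← e]
    ring
  · rw [coeff_eq_zero_of_degree_lt]
    · exact zero_mem_withConst
    · refine lt_of_lt_of_le (degree_modByMonic_lt p hmon) ?_
      rw [degree_sub_eq_left_of_degree_lt
        (by rw [degree_X_pow]; exact degree_lt_of_coeff_eq_zero hm), degree_X_pow]
      exact_mod_cast not_lt.1 hk

end Division

theorem entryCoeffsBelow_subset_withConst {F R : Type*} [Field F] [CommRing R] [Algebra F R]
    {α β : Type*} {n m : ℕ} {A : Matrix α β R[X]} (h : ∀ i j k, n ≤ k → (A i j).coeff k = 0) :
    entryCoeffsBelow m A ⊆ withConst F (entryCoeffsBelow n A) := by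
  rw [entryCoeffsBelow_subset_iff]
  intro i j k _
  by_cases hk : k < n
  · exact Or.inl (coeff_mem_entryCoeffsBelow A i j hk)
  · rw [h i j k (not_lt.1 hk)]; exact zero_mem_withConst

/-! ### The cost of the tree of products -/

section TreeCost

variable {F : Type u} [Field F] {ω K : ℝ} {R : Type u} [CommRing R] [Algebra F R]
  {T : ℕ} {g : ℕ → ℕ → R[X]} {c : ℕ → R} {S : Set R}

theorem IsMatMulExponent.computes_blockTransition (hF : IsMatMulExponent F ω K) {D : ℕ} {ν : ℝ}
    (hmul : MulsBelow F R D ν) (hD : (D : ℝ) ≤ ν)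
    (hgS : ∀ i j k, 1 ≤ j → j ≤ T → (g i j).coeff k ∈ withConst F S)
    (hcS : ∀ i, c i ∈ withConst F S) (r I : ℕ) :
    Computes F S (entryCoeffsBelow D (blockTransition T g (fun i => C (c i)) r I))
      ((3 * r + 1) * (K * ((T + 1 : ℕ) : ℝ) ^ ω * ν)) := by
  have hlow : entryCoeffsBelow D (blockLower T g (fun i => C (c i)) I) ⊆ withConst F S := by
    rw [entryCoeffsBelow_subset_iff]
    intro p q k _
    refine Fin.cases ?_ (fun a => ?_) p
    · simpa [blockLower] using zero_mem_withConst
    · refine Fin.cases ?_ (fun b => ?_) q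
      · simp only [blockLower, Matrix.of_apply, Fin.cases_succ, Fin.cases_zero, coeff_C]
        split_ifs
        · exact hcS _
        · exact zero_mem_withConst
      · have := a.2
        simp only [blockLower, Matrix.of_apply, Fin.cases_succ]
        split_ifs
        · exact hgS _ _ _ (by omega) (by omega)
        · simpa using zero_mem_withConst
  have hup : entryCoeffsBelow D (blockUpper T g I) ⊆ withConst F S := by
    rw [entryCoeffsBelow_subset_iff]
    intro p q k _
    refine Fin.cases ?_ (fun a => ?_) p
    · refine Fin.cases ?_ (fun b => ?_) q
      · simp only [blockUpper, Matrix.of_apply, Fin.cases_zero, coeff_one]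
        split_ifs
        · exact one_mem_withConst
        · exact zero_mem_withConst
      · simpa [blockUpper] using zero_mem_withConst
    · refine Fin.cases ?_ (fun b => ?_) q
      · simpa [blockUpper] using zero_mem_withConst
      · have := b.2
        simp only [blockUpper, Matrix.of_apply, Fin.cases_succ]
        split_ifs
        · exact hgS _ _ _ (by omega) (by omega)
        · simpa using zero_mem_withConst
  have hmat := fun A B : Matrix (Fin (T + 1)) (Fin (T + 1)) R[X] =>
    hF.computes_mul (Nat.le_add_left 1 T) hmul hD A B
  have hone : entryCoeffsBelow D (1 : Matrix (Fin (T + 1)) (Fin (T + 1)) R[X]) ⊆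
      withConst F ∅ := by
    rw [entryCoeffsBelow_subset_iff]
    intro p q k _
    rw [Matrix.one_apply]
    split_ifs
    · rw [coeff_one]
      split_ifs
      · exact one_mem_withConst
      · exact zero_mem_withConst
    · exact zero_mem_withConst
  have h1 := ((Computes.geom_sum (entryCoeffsBelow D) hmat
    (fun A B => Computes.entryCoeffs_add D A B) hone (blockLower T g (fun i => C (c i)) I)
    r).mono_right fun _ hx => Or.inl (Or.inl hx)).mono_left hlow
  have h2 := h1.trans_right ((hmat _ (blockUpper T g I)).mono_left (S' := S ∪ _)
    (Set.union_subset (fun _ hx => Or.inl (Or.inr hx))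
      (hup.trans (withConst_mono Set.subset_union_left))))
  refine h2.mono_cost ?_
  simp only [Fintype.card_fin]
  have h3 := hF.sq_le (Nat.le_add_left 1 T)
  -- A matrix addition costs no more than a matrix multiplication, so each of the `r` squaring
  -- rounds counts as three multiplications; the last one is the product with `blockUpper`.
  have h4 : ((T + 1 : ℕ) : ℝ) * (((T + 1 : ℕ) : ℝ) * D) ≤ K * ((T + 1 : ℕ) : ℝ) ^ ω * ν := by
    rw [← mul_assoc, ← sq]
    exact mul_le_mul h3 hD (Nat.cast_nonneg D) ((sq_nonneg _).trans h3)
  nlinarith [mul_le_mul_of_nonneg_left h4 (Nat.cast_nonneg (α := ℝ) r)]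

variable {M : ℕ → ℝ} {Q : ℕ → Matrix (Fin (T + 1)) (Fin (T + 1)) R[X]}

/-- The coefficients of the entries of the products in level `l` of a tree of height `h`. -/
def prodLevel (Q : ℕ → Matrix (Fin (T + 1)) (Fin (T + 1)) R[X]) (h l : ℕ) : Set R :=
  ⋃ k ∈ Finset.range (2 ^ (h - l)), entryCoeffsBelow (8 * (2 ^ l * T)) (prodTree Q l k)

/-- The coefficients of the entries of the row vectors in level `l` of a tree of height `h`. -/
def rowLevel (Q : ℕ → Matrix (Fin (T + 1)) (Fin (T + 1)) R[X]) (v : ℕ → Fin (T + 1) → R[X])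
    (h l : ℕ) : Set R :=
  ⋃ k ∈ Finset.range (2 ^ (h - l)), ⋃ q, coeffsBelow (8 * (2 ^ l * T)) (rowTree Q v l k q)

/-- Superadditivity gathers the `2 ^ (h - l)` multiplications of size `2 ^ l * T` into one of size
`2 ^ h * T ≤ N`. -/
theorem level_cost_le (hM1 : ∀ n, 1 ≤ M n)
    (hM : ∀ a b : ℕ, 1 ≤ a → 1 ≤ b → M a + M b ≤ M (a + b)) (hT : 1 ≤ T) {h l N : ℕ}
    (hl : l ≤ h) (hN : 2 ^ h * T ≤ N) : (2 ^ (h - l) : ℝ) * M (2 ^ l * T) ≤ M N := by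
  have h1 : 1 ≤ 2 ^ l * T := Nat.mul_pos (by positivity) hT
  have := mul_le_of_superadditive hM (a := 2 ^ (h - l)) Nat.one_le_two_pow h1
  rw [← mul_assoc, ← pow_add, Nat.sub_add_cancel hl] at this
  push_cast at this
  exact this.trans (mono_of_superadditive hM hM1 (Nat.mul_pos (by positivity) hT) hN)

/-- Entries on level `l + 1` have degree at most `2 ^ (l + 1) * T + T ≤ 3 * (2 ^ l * T)`, so
arithmetic modulo `X ^ (8 * (2 ^ l * T))` is exact for them. By `MulsBelow.eight_mul` it is charged
to `M (2 ^ l * T)`, with the factor `400`. -/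
theorem IsMatMulExponent.computes_prodLevel (hF : IsMatMulExponent F ω K) (hM1 : ∀ n, 1 ≤ M n)
    (hM : ∀ a b : ℕ, 1 ≤ a → 1 ≤ b → M a + M b ≤ M (a + b))
    (hmul : ∀ L, 1 ≤ L → MulsBelow F R L (M L)) (hT : 1 ≤ T)
    (hQ : ∀ I, WeightedDegreeLE T (Q I)) {h l N : ℕ} (hl : l ≤ h) (hN : 2 ^ h * T ≤ N) :
    Computes F (prodLevel Q (h + 1) l) (prodLevel Q (h + 1) (l + 1))
      (400 * (K * ((T + 1 : ℕ) : ℝ) ^ ω * M N)) := by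
  have hL : 1 ≤ 2 ^ l * T := Nat.mul_pos (by positivity) hT
  have hLM := self_le_of_superadditive hM hM1 hL
  have hmul8 := (hmul _ hL).eight_mul hLM
  have hK : 0 ≤ K * ((T + 1 : ℕ) : ℝ) ^ ω :=
    (sq_nonneg _).trans (hF.sq_le (Nat.le_add_left 1 T))
  have h1 := Computes.biUnion (F := F) (S := prodLevel Q (h + 1) l)
    (Finset.range (2 ^ (h + 1 - (l + 1)))) (fun k hk => by
      refine ((hF.computes_mul (Nat.le_add_left 1 T) hmul8 (by push_cast at hLM ⊢; linarith [hM1 (2 ^ l * T)])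
        (prodTree Q l (2 * k + 1)) (prodTree Q l (2 * k))).mono_left
          (S' := prodLevel Q (h + 1) l) ?_).mono_right
          (T' := entryCoeffsBelow (8 * (2 ^ (l + 1) * T)) (prodTree Q (l + 1) k)) ?_
      · have e : 2 ^ (h + 1 - l) = 2 * 2 ^ (h + 1 - (l + 1)) := by
          rw [show h + 1 - l = (h + 1 - (l + 1)) + 1 by omega, pow_succ, mul_comm]
        rw [Finset.mem_range] at hk
        refine Set.union_subset ?_ ?_ <;> intro x hx <;>
          refine Or.inl (Set.mem_biUnion (Finset.mem_coe.2 (Finset.mem_range.2 ?_)) hx) <;> omega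
      · refine entryCoeffsBelow_subset_withConst fun p q j hj => ?_
        refine WeightedDegreeLE.prodTree hQ (l + 1) k p q j ?_
        have := p.2
        have : T ≤ 2 ^ l * T := Nat.le_mul_of_pos_left T (by positivity)
        rw [pow_succ, mul_right_comm]
        omega)
  refine h1.mono_cost ?_
  rw [Finset.sum_const, Finset.card_range, nsmul_eq_mul]
  have := mul_le_mul_of_nonneg_left (level_cost_le hM1 hM hT hl hN) hK
  rw [Nat.add_sub_add_right]
  push_cast
  push_cast at this
  linarith

theorem computes_rowLevel (hM1 : ∀ n, 1 ≤ M n)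
    (hM : ∀ a b : ℕ, 1 ≤ a → 1 ≤ b → M a + M b ≤ M (a + b))
    (hmul : ∀ L, 1 ≤ L → MulsBelow F R L (M L)) (hT : 1 ≤ T)
    (hQ : ∀ I, WeightedDegreeLE T (Q I)) {v : ℕ → Fin (T + 1) → R[X]}
    (hv : ∀ (I : ℕ) (q : Fin (T + 1)) (k : ℕ), T + T < k + q → (v I q).coeff k = 0)
    {h l N : ℕ} (hl : l ≤ h) (hN : 2 ^ h * T ≤ N) :
    Computes F (prodLevel Q (h + 1) l ∪ rowLevel Q v (h + 1) l) (rowLevel Q v (h + 1) (l + 1))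
      (416 * (((T + 1 : ℕ) : ℝ) ^ 2 * M N)) := by
  have hL : 1 ≤ 2 ^ l * T := Nat.mul_pos (by positivity) hT
  have hLM := self_le_of_superadditive hM hM1 hL
  have hmul8 := (hmul _ hL).eight_mul hLM
  have h1 := Computes.biUnion (F := F) (S := prodLevel Q (h + 1) l ∪ rowLevel Q v (h + 1) l)
    (Finset.range (2 ^ (h + 1 - (l + 1)))) (fun k hk => by
      have e : 2 ^ (h + 1 - l) = 2 * 2 ^ (h + 1 - (l + 1)) := by
        rw [show h + 1 - l = (h + 1 - (l + 1)) + 1 by omega, pow_succ, mul_comm]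
      rw [Finset.mem_range] at hk
      have hrow : ∀ k', k' < 2 ^ (h + 1 - l) →
          (⋃ q, coeffsBelow (8 * (2 ^ l * T)) (rowTree Q v l k' q)) ⊆
            prodLevel Q (h + 1) l ∪ rowLevel Q v (h + 1) l := fun k' hk' x hx =>
        Or.inr (Set.mem_biUnion (Finset.mem_coe.2 (Finset.mem_range.2 hk')) hx)
      have h2 := (Computes.coeffs_vecMul hmul8 (rowTree Q v l (2 * k + 1))
        (prodTree Q l (2 * k))).mono_left
          (S' := prodLevel Q (h + 1) l ∪ rowLevel Q v (h + 1) l) (by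
            refine Set.union_subset (fun x hx => Or.inl (hrow _ (by omega) hx)) (fun x hx => ?_)
            refine Or.inl (Or.inl (Set.mem_biUnion (Finset.mem_coe.2 (Finset.mem_range.2 ?_)) hx))
            omega)
      refine (h2.trans_right (Computes.iUnion fun q => (Computes.coeffs_add (8 * (2 ^ l * T))
        (rowTree Q v l (2 * k) q) (Matrix.vecMul (rowTree Q v l (2 * k + 1))
          (prodTree Q l (2 * k)) q)).mono_left (S' := _ ∪ _) ?_)).mono_right
          (T' := ⋃ q, coeffsBelow (8 * (2 ^ (l + 1) * T)) (rowTree Q v (l + 1) k q)) ?_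
      · exact Set.union_subset
          (fun x hx => Or.inl (Or.inl (hrow (2 * k) (by omega) (Set.mem_iUnion.2 ⟨q, hx⟩))))
          (fun x hx => Or.inl (Or.inr (Set.mem_iUnion.2 ⟨q, hx⟩)))
      · refine Set.iUnion_subset fun q => ?_
        refine (coeffsBelow_subset_withConst (n := 8 * (2 ^ l * T)) fun j hj => ?_).trans
          (withConst_mono (Set.subset_iUnion
            (fun q => coeffsBelow (8 * (2 ^ l * T)) (rowTree Q v (l + 1) k q)) q))
        refine coeff_rowTree_eq_zero hQ hv (l + 1) k q j ?_
        have : T ≤ 2 ^ l * T := Nat.le_mul_of_pos_left T (by positivity)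
        rw [pow_succ, mul_right_comm]
        omega)
  refine h1.mono_cost ?_
  rw [Finset.sum_const, Finset.card_range, nsmul_eq_mul]
  have h3 := mul_le_mul_of_nonneg_left (level_cost_le hM1 hM hT hl hN)
    (sq_nonneg ((T + 1 : ℕ) : ℝ))
  rw [Nat.add_sub_add_right]
  simp only [Fintype.card_fin]
  have h4 : (1 : ℝ) ≤ ((T + 1 : ℕ) : ℝ) := by exact_mod_cast Nat.le_add_left 1 T
  -- Here `416 = 400 + 8 + 8`: products, additions inside the vector-matrix product, and addition of
  -- the left row.
  have h5 : ((T + 1 : ℕ) : ℝ) * (((T + 1 : ℕ) : ℝ) * (400 * M (2 ^ l * T) +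
        (8 * (2 ^ l * T) : ℕ))) + ((T + 1 : ℕ) : ℝ) * (8 * (2 ^ l * T) : ℕ) ≤
      416 * (((T + 1 : ℕ) : ℝ) ^ 2 * M (2 ^ l * T)) := by
    have e : ((8 * (2 ^ l * T) : ℕ) : ℝ) = 8 * ((2 ^ l * T : ℕ) : ℝ) := by push_cast; ring
    rw [e]
    generalize ((T + 1 : ℕ) : ℝ) = n at *
    generalize ((2 ^ l * T : ℕ) : ℝ) = L at *
    generalize M (2 ^ l * T) = μ at *
    have hμ : n * L ≤ n ^ 2 * μ := by nlinarith [mul_nonneg (sub_nonneg.2 h4) (sub_nonneg.2 h4)]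
    have hμ' : n ^ 2 * L ≤ n ^ 2 * μ := mul_le_mul_of_nonneg_left hLM (sq_nonneg n)
    nlinarith
  refine (mul_le_mul_of_nonneg_left h5 (Nat.cast_nonneg _)).trans ?_
  push_cast at h3 ⊢
  linarith

end TreeCost

/-! ### The algorithm -/

section Algorithm

variable {F : Type u} [Field F] {ω K : ℝ} {R : Type u} [CommRing R] [Algebra F R]
  {M : ℕ → ℝ} {T : ℕ} {g : ℕ → ℕ → R[X]} {c : ℕ → R} {S : Set R}

theorem IsMatMulExponent.computes_prodLevels (hF : IsMatMulExponent F ω K)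
    (hM1 : ∀ n, 1 ≤ M n) (hM : ∀ a b : ℕ, 1 ≤ a → 1 ≤ b → M a + M b ≤ M (a + b))
    (hmul : ∀ L, 1 ≤ L → MulsBelow F R L (M L)) (hT : 1 ≤ T)
    (hg : ∀ i j k, 1 ≤ j → j ≤ T → j < k → (g i j).coeff k = 0)
    (hgS : ∀ i j k, 1 ≤ j → j ≤ T → (g i j).coeff k ∈ withConst F S)
    (hcS : ∀ i, c i ∈ withConst F S) (r : ℕ) {h N : ℕ} (hN : 2 ^ h * T ≤ N) :
    Computes F S (⋃ l ∈ Finset.range (h + 1 + 1),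
        prodLevel (blockTransition T g (fun i => C (c i)) r) (h + 1) l)
      ((2400 * r + 800 + 400 * (h + 1)) * (K * ((T + 1 : ℕ) : ℝ) ^ ω * M N)) := by
  set Q := blockTransition T g (fun i => C (c i)) r
  have hK : 0 ≤ K * ((T + 1 : ℕ) : ℝ) ^ ω :=
    (sq_nonneg _).trans (hF.sq_le (Nat.le_add_left 1 T))
  have hTM := self_le_of_superadditive hM hM1 hT
  -- A tree of height `h + 1` has `2 * 2 ^ h` leaves, each costing `3 * r + 1` matrix products with
  -- factor `400`.
  have h0 : Computes F S (prodLevel Q (h + 1) 0)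
      ((2400 * r + 800) * (K * ((T + 1 : ℕ) : ℝ) ^ ω * M N)) := by
    have h1 := Computes.biUnion (F := F) (S := S) (Finset.range (2 ^ (h + 1 - 0))) fun k _ =>
      hF.computes_blockTransition (D := 8 * (2 ^ 0 * T)) (ν := 400 * M T)
        (by simpa using (hmul T hT).eight_mul hTM) (by push_cast; linarith [hM1 T]) hgS hcS r k
    refine h1.mono_cost ?_
    rw [Finset.sum_const, Finset.card_range, nsmul_eq_mul]
    have h2 := level_cost_le hM1 hM hT (Nat.zero_le h) hN
    have h3 := mul_le_mul_of_nonneg_left h2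
      (mul_nonneg (by positivity : (0 : ℝ) ≤ 2400 * r + 800) hK)
    simp only [Nat.sub_zero, pow_zero, one_mul] at h3 ⊢
    rw [pow_succ]
    push_cast at h3 ⊢
    linarith
  refine (Computes.chain (h + 1) (fun l hl => (hF.computes_prodLevel hM1 hM hmul hT
    (weightedDegreeLE_blockTransition hg r) (Nat.lt_succ_iff.1 hl) hN).mono_left
      fun _ hx => Or.inl (Or.inr hx)) h0).mono_cost (le_of_eq ?_)
  push_cast
  ring

theorem computes_rowLevels (hM1 : ∀ n, 1 ≤ M n)
    (hM : ∀ a b : ℕ, 1 ≤ a → 1 ≤ b → M a + M b ≤ M (a + b))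
    (hmul : ∀ L, 1 ≤ L → MulsBelow F R L (M L)) (hT : 1 ≤ T)
    {Q : ℕ → Matrix (Fin (T + 1)) (Fin (T + 1)) R[X]} (hQ : ∀ I, WeightedDegreeLE T (Q I))
    {b : ℕ → R} (hbS : ∀ i, b i ∈ withConst F S) {h N : ℕ} (hN : 2 ^ h * T ≤ N)
    (hQS : ∀ l < h + 2, prodLevel Q (h + 1) l ⊆ S) :
    Computes F S (rowLevel Q
        (fun I => Matrix.vecMul (blockWeights T (fun i => C (b i)) I) (Q I)) (h + 1) (h + 1))
      ((816 + 416 * (h + 1)) * (((T + 1 : ℕ) : ℝ) ^ 2 * M N)) := by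
  set v := fun I => Matrix.vecMul (blockWeights T (fun i => C (b i)) I) (Q I)
  have hTM := self_le_of_superadditive hM hM1 hT
  have h0 : Computes F S (rowLevel Q v (h + 1) 0) (816 * (((T + 1 : ℕ) : ℝ) ^ 2 * M N)) := by
    have h1 := Computes.biUnion (F := F) (S := S) (Finset.range (2 ^ (h + 1 - 0)))
      (T := fun k => ⋃ q, coeffsBelow (8 * (2 ^ 0 * T)) (v k q)) fun k hk =>
      (Computes.coeffs_vecMul (n := 8 * (2 ^ 0 * T)) (c := 400 * M T)
        (by simpa using (hmul T hT).eight_mul hTM) (blockWeights T (fun i => C (b i)) k)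
        (Q k)).mono_left (S' := S) (by
          refine Set.union_subset (Set.iUnion_subset fun q => ?_) fun x hx =>
            Or.inl (hQS 0 (by omega) (Set.mem_biUnion hk hx))
          rintro _ ⟨j, -, rfl⟩
          refine Fin.cases ?_ (fun a => ?_) q
          · simpa [blockWeights] using zero_mem_withConst
          · rw [blockWeights, Fin.cons_succ, coeff_C]
            split_ifs
            · exact hbS _
            · exact zero_mem_withConst)
    refine h1.mono_cost ?_
    rw [Finset.sum_const, Finset.card_range, nsmul_eq_mul]
    have h2 := level_cost_le hM1 hM hT (Nat.zero_le h) hN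
    have h3 := mul_le_mul_of_nonneg_left h2 (sq_nonneg ((T + 1 : ℕ) : ℝ))
    have h4 : (0 : ℝ) ≤ 2 ^ (h + 1) * ((T + 1 : ℕ) : ℝ) ^ 2 := by positivity
    have h5 := mul_le_mul_of_nonneg_left hTM h4
    simp only [Nat.sub_zero, pow_zero, one_mul, Fintype.card_fin] at h3 ⊢
    rw [pow_succ] at h5 ⊢
    push_cast at h3 h5 ⊢
    linarith
  have hv : ∀ (I : ℕ) (q : Fin (T + 1)) (k : ℕ), T + T < k + q → (v I q).coeff k = 0 := by
    intro I q k hk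
    refine coeff_vecMul_eq_zero (e := 0) (w := T) (fun q k hk => ?_) (hQ I) q k (by omega)
    rcases Fin.eq_zero_or_eq_succ q with rfl | ⟨a, rfl⟩
    · simp [blockWeights]
    · rw [blockWeights, Fin.cons_succ, coeff_C, if_neg]
      have := a.2
      simp only [Fin.val_succ] at hk
      omega
  refine ((Computes.chain (h + 1) (fun l hl => (computes_rowLevel hM1 hM hmul hT hQ hv
    (Nat.lt_succ_iff.1 hl) hN).mono_left (Set.union_subset
      (fun _ hx => Or.inl (Or.inl (hQS l (by omega) hx)))
      fun _ hx => Or.inl (Or.inr hx))) h0).mono_cost (le_of_eq ?_)).mono_right fun _ hx =>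
        Or.inl (Set.mem_biUnion (Finset.mem_coe.2 (Finset.self_mem_range_succ (h + 1))) hx)
  push_cast
  ring

theorem IsMatMulExponent.exists_computes [Nontrivial R] (hF : IsMatMulExponent F ω K)
    (hM1 : ∀ n, 1 ≤ M n) (hM : ∀ a b : ℕ, 1 ≤ a → 1 ≤ b → M a + M b ≤ M (a + b))
    (hmul : ∀ L, 1 ≤ L → MulsBelow F R L (M L)) {N : ℕ} (hT : 1 ≤ T) (hTN : T ≤ N)
    {b : ℕ → R} {d m : R[X]} {S' : Set R}
    (hg : ∀ i j k, 1 ≤ j → j ≤ T → j < k → (g i j).coeff k = 0)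
    (hd : ∀ k, N ≤ k → d.coeff k = 0) (hm : ∀ k, N ≤ k → m.coeff k = 0)
    (hb : ∀ i, N ≤ i → b i = 0)
    (hgS : ∀ i j k, 1 ≤ j → j ≤ T → (g i j).coeff k ∈ withConst F S)
    (hcS : ∀ i, c i ∈ withConst F S) (hdS : ∀ k, d.coeff k ∈ withConst F S)
    (hmS : ∀ k, m.coeff k ∈ withConst F S) (hbS : ∀ i, b i ∈ withConst F S') :
    ∃ U : Set R,
      Computes F S U (3603 * (Nat.log 2 N + 1) * (K * ((T + 1 : ℕ) : ℝ) ^ ω * M N)) ∧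
      Computes F (S ∪ U ∪ S') (Set.range (((∑ i ∈ Finset.range N,
          C (b i) * recSol T g (fun i => C (c i)) (T + i)) * d) %ₘ (X ^ N - m)).coeff)
        (1236 * (Nat.log 2 N + 1) * (((T + 1 : ℕ) : ℝ) ^ 2 * M N)) := by
  set r := Nat.log 2 N + 1
  -- This gives `2 ^ h * T ≤ N < 2 ^ (h + 1) * T`: the left inequality bounds the cost, the right
  -- one makes a tree of height `h + 1` cover all `N` indices. Surplus indices carry the weight `b i
  -- = 0`.
  set h := Nat.log 2 (N / T)
  have hN1 : 1 ≤ N := hT.trans hTN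
  have hr : N < 2 ^ r := Nat.lt_pow_succ_log_self (by norm_num) N
  have hNT : N / T ≠ 0 := (Nat.div_pos hTN hT).ne'
  have hhN : 2 ^ h * T ≤ N := (Nat.mul_le_mul_right T (Nat.pow_log_le_self 2 hNT)).trans
    (Nat.div_mul_le_self N T)
  have hhN' : N < 2 ^ (h + 1) * T :=
    (Nat.div_lt_iff_lt_mul hT).1 (Nat.lt_pow_succ_log_self (by norm_num) (N / T))
  have hhr : h + 1 ≤ r := Nat.succ_le_succ (Nat.log_mono_right (Nat.div_le_self N T))
  have hhr' : (h : ℝ) + 1 ≤ r := by exact_mod_cast hhr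
  have hr1 : (1 : ℝ) ≤ r := by exact_mod_cast Nat.le_add_left 1 _
  have hrr : (Nat.log 2 N : ℝ) + 1 = r := by simp [r]
  have hNM := self_le_of_superadditive hM hM1 hN1
  have hn1 : (1 : ℝ) ≤ ((T + 1 : ℕ) : ℝ) ^ 2 :=
    one_le_pow₀ (by exact_mod_cast Nat.le_add_left 1 T)
  have hnK := hF.sq_le (Nat.le_add_left 1 T)
  have hM0 : 0 ≤ M N := zero_le_one.trans (hM1 N)
  set Q := blockTransition T g (fun i => C (c i)) r
  set v := fun I => Matrix.vecMul (blockWeights T (fun i => C (b i)) I) (Q I)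
  set s := ∑ i ∈ Finset.range N, C (b i) * recSol T g (fun i => C (c i)) (T + i)
  refine ⟨(⋃ l ∈ Finset.range (h + 1 + 1), prodLevel Q (h + 1) l) ∪
    coeffsBelow N (reversalInverse N r m), ?_, ?_⟩
  · refine ((hF.computes_prodLevels hM1 hM hmul hT hg hgS hcS r hhN).union
      ((Computes.reversalInverse (hmul N hN1) r hN1).mono_left
        (by rintro _ ⟨k, -, rfl⟩; exact hmS k))).mono_cost ?_
    rw [hrr]
    have h1 : M N ≤ K * ((T + 1 : ℕ) : ℝ) ^ ω * M N :=
      le_mul_of_one_le_left hM0 (hn1.trans hnK)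
    generalize K * ((T + 1 : ℕ) : ℝ) ^ ω * M N = κ at *
    have h2 : (r : ℝ) * (2 * M N + N) ≤ r * (3 * κ) :=
      mul_le_mul_of_nonneg_left (by linarith) (by linarith)
    have h3 : ((h : ℝ) + 1) * κ ≤ r * κ := mul_le_mul_of_nonneg_right hhr' (by linarith)
    have h4 : 1 * κ ≤ r * κ := mul_le_mul_of_nonneg_right hr1 (by linarith)
    linarith
  · set U := (⋃ l ∈ Finset.range (h + 1 + 1), prodLevel Q (h + 1) l) ∪
      coeffsBelow N (reversalInverse N r m)
    have hs : s = rowTree Q v (h + 1) 0 0 := by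
      rw [rowTree_zero_eq_sum (by omega)]
      refine Finset.sum_subset (Finset.range_mono hhN'.le) fun i _ hi => ?_
      rw [hb i (by simpa using hi), C_0, zero_mul]
    have hsN : ∀ k, N ≤ k → s.coeff k = 0 := by
      intro k hk
      refine coeff_sum_mul_eq_zero _ fun i hi a b hab => ?_
      rw [Finset.mem_range] at hi
      by_cases ha : a = 0
      · exact Or.inr (coeff_recSol_eq_zero hg _ _ (by omega))
      · exact Or.inl (by rw [coeff_C, if_neg ha])
    have h1 : Computes F (S ∪ U ∪ S') (coeffsBelow N s)
        ((816 + 416 * (h + 1)) * (((T + 1 : ℕ) : ℝ) ^ 2 * M N)) := by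
      refine (computes_rowLevels hM1 hM hmul hT (weightedDegreeLE_blockTransition hg r)
        (fun i => withConst_mono Set.subset_union_right (hbS i)) hhN fun l hl x hx =>
          Or.inl (Or.inr (Or.inl
            (Set.mem_biUnion (Finset.mem_coe.2 (Finset.mem_range.2 hl)) hx)))).mono_right ?_
      rintro _ ⟨k, hk, rfl⟩
      have hk : k < N := hk
      refine Or.inl (Set.mem_biUnion (x := 0) (by simp) (Set.mem_iUnion.2 ⟨0, ?_⟩))
      rw [hs]
      exact coeff_mem_coeffsBelow _ (by omega)
    have h2 := h1.trans_right ((hmul N hN1 s d hsN hd).mono_left (S' := S ∪ U ∪ S' ∪ _)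
      (Set.union_subset (fun _ hx => Or.inl (Or.inr hx)) (by
        rintro _ ⟨k, -, rfl⟩
        exact withConst_mono (fun _ hx => Or.inl (Or.inl (Or.inl hx))) (hdS k))))
    have h3 := h2.trans_right ((Computes.modByMonic (hmul N hN1) hN1 hm hr.le (p := s * d)
      fun k hk => coeff_mul_eq_zero_of_le hsN hd (by omega)).mono_left
        (S' := S ∪ U ∪ S' ∪ Set.range (s * d).coeff)
        (Set.union_subset (fun _ hx => Or.inl (Or.inr hx)) (Set.union_subset (by
          rintro _ ⟨k, -, rfl⟩
          exact withConst_mono (fun _ hx => Or.inl (Or.inl (Or.inl hx))) (hmS k))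
          (fun _ hx => Or.inl (Or.inl (Or.inl (Or.inr (Or.inr hx))))))))
    refine h3.mono_cost ?_
    rw [hrr]
    have h4 : M N ≤ ((T + 1 : ℕ) : ℝ) ^ 2 * M N := le_mul_of_one_le_left hM0 hn1
    generalize ((T + 1 : ℕ) : ℝ) ^ 2 * M N = κ at *
    have h5 : ((h : ℝ) + 1) * κ ≤ r * κ := mul_le_mul_of_nonneg_right hhr' (by linarith)
    have h6 : 1 * κ ≤ r * κ := mul_le_mul_of_nonneg_right hr1 (by linarith)
    linarith

end Algorithm

/-! ### Correctness -/

theorem rowPoly_eq_vecPoly {F : Type*} [Field F] {N : ℕ} (A : Matrix (Fin N) (Fin N) F)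
    (i : Fin N) : rowPoly A i = vecPoly (A i) := by
  rw [rowPoly, dif_pos i.2]

theorem RecurrenceData.modulus_eq {F : Type*} [Field F] {N t : ℕ} (D : RecurrenceData F N t) :
    D.modulus = X ^ N - vecPoly D.m := charpoly_companion D.m

theorem RecurrenceData.modulus_monic {F : Type*} [Field F] {N t : ℕ}
    (D : RecurrenceData F N t) : D.modulus.Monic := Matrix.charpoly_monic _

/-- The product with the transpose is obtained from the solution of the recurrence over the
polynomial ring with the constants `c i` as inhomogeneous terms. -/
theorem RecurrenceData.Generates.coeff_modByMonic {F : Type*} [Field F] {N t : ℕ}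
    {D : RecurrenceData F N t} {A : Matrix (Fin N) (Fin N) F} (hA : D.Generates A)
    {y : ℕ → F[X]} (hy : ∀ i : Fin N, y i =
      ∑ j ∈ Finset.Icc 1 (min t (i : ℕ)), D.g i j * y ((i : ℕ) - j) + C (D.c i))
    (b : Fin N → F) (k : Fin N) :
    (((∑ i : Fin N, C (b i) * y i) * vecPoly D.d) %ₘ D.modulus).coeff k =
      (A.transpose.mulVec b) k := by
  -- The differences between row polynomials and `y n * d` satisfy the homogeneous recurrence up to
  -- multiples of the modulus, so all of them are divisible by it.
  have hdvd : ∀ n (hn : n < N), D.modulus ∣ rowPoly A n - y n * vecPoly D.d := by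
    intro n
    induction n using Nat.strong_induction_on with
    | _ n ih =>
      intro hn
      have h1 := hA ⟨n, hn⟩
      have h2 := hy ⟨n, hn⟩
      simp only at h1 h2
      rw [h2]
      have h3 := modByMonic_add_div (∑ j ∈ Finset.Icc 1 (min t n), D.g ⟨n, hn⟩ j *
        rowPoly A (n - j) + C (D.c ⟨n, hn⟩) * vecPoly D.d) D.modulus
      rw [← h1] at h3
      rw [eq_sub_of_add_eq h3]
      have e : ∑ j ∈ Finset.Icc 1 (min t n), D.g ⟨n, hn⟩ j * rowPoly A (n - j) +
          C (D.c ⟨n, hn⟩) * vecPoly D.d -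
          (∑ j ∈ Finset.Icc 1 (min t n), D.g ⟨n, hn⟩ j * y (n - j) + C (D.c ⟨n, hn⟩)) *
            vecPoly D.d =
          ∑ j ∈ Finset.Icc 1 (min t n), D.g ⟨n, hn⟩ j *
            (rowPoly A (n - j) - y (n - j) * vecPoly D.d) := by
        simp only [mul_sub, Finset.sum_sub_distrib, add_mul, Finset.sum_mul, mul_assoc]
        ring
      rw [sub_right_comm, e]
      refine dvd_sub (Finset.dvd_sum fun j hj => Dvd.dvd.mul_left ?_ _) (dvd_mul_right _ _)
      rw [Finset.mem_Icc] at hj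
      exact ih _ (by omega) (by omega)
  have hdeg : (∑ i : Fin N, C (b i) * rowPoly A i).degree < D.modulus.degree := by
    rw [RecurrenceData.modulus, Matrix.charpoly_degree_eq_dim, Fintype.card_fin]
    rw [degree_lt_iff_coeff_zero]
    intro k hk
    rw [finsetSum_coeff]
    refine Finset.sum_eq_zero fun i _ => ?_
    rw [coeff_C_mul, rowPoly_eq_vecPoly, coeff_vecPoly, dif_neg (not_lt.2 hk), mul_zero]
  have hmod : ((∑ i : Fin N, C (b i) * y i) * vecPoly D.d) %ₘ D.modulus =
      ∑ i : Fin N, C (b i) * rowPoly A i := by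
    rw [← (modByMonic_eq_self_iff D.modulus_monic).2 hdeg]
    refine modByMonic_eq_of_dvd_sub D.modulus_monic ?_
    rw [Finset.sum_mul, ← Finset.sum_sub_distrib]
    refine Finset.dvd_sum fun i _ => ?_
    rw [mul_assoc, ← mul_sub, ← neg_sub, mul_neg, dvd_neg]
    exact Dvd.dvd.mul_left (hdvd i i.2) _
  rw [hmod, finsetSum_coeff]
  simp only [Matrix.mulVec, dotProduct, Matrix.transpose_apply, coeff_C_mul, rowPoly_eq_vecPoly,
    coeff_vecPoly, k.2, dif_pos, Fin.eta]
  exact Finset.sum_congr rfl fun i _ => mul_comm _ _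

/-- The second program has more inputs than the first; what the first one left readable stays so. -/
theorem Readable.sum_inl {F : Type*} [Field F] {ι κ R : Type*} [CommRing R] [Algebra F R]
    {x : ι → R} {mem : List R} {a : R} (h : Readable F x mem a) (y : κ → R) :
    Readable F (Sum.elim x y) mem a := by
  rcases h.cases with ⟨b, rfl⟩ | ⟨i, rfl⟩ | h
  · exact readable_algebraMap _ _ b
  · exact ⟨.input (.inl i), rfl⟩
  · exact readable_of_mem _ h

/-- The polynomial with coefficients `a 0, …, a (n - 1)`. -/
noncomputable def polyOfCoeffs {R : Type*} [CommRing R] (n : ℕ) (a : ℕ → R) : R[X] :=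
  ∑ k ∈ Finset.range n, monomial k (a k)

theorem coeff_polyOfCoeffs {R : Type*} [CommRing R] (n : ℕ) (a : ℕ → R) (k : ℕ) :
    (polyOfCoeffs n a).coeff k = if k < n then a k else 0 := by
  simp [polyOfCoeffs, coeff_monomial]

/-- Both summands are at most `log N / log 2`, and `2 / log 2 < 3`. -/
theorem log_two_add_one_le {N : ℕ} (hN : 2 ≤ N) : (Nat.log 2 N : ℝ) + 1 ≤ 3 * Real.log N := by
  have h1 : (Nat.log 2 N : ℝ) * Real.log 2 ≤ Real.log N := by
    rw [← Real.log_pow]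
    refine Real.log_le_log (by positivity) ?_
    exact_mod_cast Nat.pow_log_le_self 2 (by omega)
  have h2 : Real.log 2 ≤ Real.log N := Real.log_le_log (by norm_num) (by exact_mod_cast hN)
  have h3 := Real.log_two_gt_d9
  have h4 : (0 : ℝ) ≤ Nat.log 2 N := Nat.cast_nonneg _
  nlinarith

/-! ### The generic instance: inputs as functions on the set of all instances -/

section GenericInstance

variable {F : Type u} [Field F] {N t : ℕ}

/-- An input value, as a function of the generators and the vector `b`. -/
noncomputable def genericInput (F : Type u) [Field F] (N t : ℕ) (i : GenIndex N t) :
    RecurrenceData F N t × (Fin N → F) → F :=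
  fun e => e.1.inputs i

/-- The generators `g i j` with coefficients in the ring of functions of the instance. -/
noncomputable def genericG (F : Type u) [Field F] (N t : ℕ) (i j : ℕ) :
    (RecurrenceData F N t × (Fin N → F) → F)[X] :=
  polyOfCoeffs (j + 1) fun k e => if h : i < N then (e.1.g ⟨i, h⟩ j).coeff k else 0

/-- A sequence of `N` functions of the instance, continued by zeros. -/
def extendByZero {E F : Type*} [Field F] {N : ℕ} (a : E → Fin N → F) (i : ℕ) : E → F :=
  fun e => if h : i < N then a e ⟨i, h⟩ else 0

theorem extendByZero_mem_withConst {E F : Type*} [Field F] {N : ℕ} (a : E → Fin N → F)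
    {S : Set (E → F)} (h : ∀ i : Fin N, (fun e => a e i) ∈ S) (i : ℕ) :
    extendByZero a i ∈ withConst F S := by
  by_cases hi : i < N
  · rw [show extendByZero a i = fun e => a e ⟨i, hi⟩ from funext fun e => dif_pos hi]
    exact Or.inl (h ⟨i, hi⟩)
  · rw [show extendByZero a i = 0 from funext fun e => dif_neg hi]
    exact zero_mem_withConst

theorem map_polyOfCoeffs_extendByZero {E F : Type*} [Field F] {N : ℕ} (a : E → Fin N → F)
    (e : E) :
    (polyOfCoeffs N (extendByZero a)).map (Pi.evalRingHom (fun _ => F) e) = vecPoly (a e) := by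
  ext k
  rw [coeff_map, coeff_polyOfCoeffs, coeff_vecPoly]
  by_cases hk : k < N <;> simp [extendByZero, hk]

theorem map_genericG (e : RecurrenceData F N t × (Fin N → F)) (i : Fin N) {j : ℕ} (hj : 1 ≤ j)
    (hjt : j ≤ t) :
    (genericG F N t i j).map (Pi.evalRingHom (fun _ => F) e) = e.1.g i j := by
  ext k
  rw [coeff_map, genericG, coeff_polyOfCoeffs]
  by_cases hk : k < j + 1
  · simp [hk]
  · rw [if_neg hk, map_zero]
    exact (coeff_eq_zero_of_natDegree_lt
      (lt_of_le_of_lt (e.1.natDegree_g_le i j hj hjt) (by omega))).symm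

theorem coeff_genericG_mem {i j k : ℕ} (hj : 1 ≤ j) (hjt : j ≤ t) :
    (genericG F N t i j).coeff k ∈ withConst F (Set.range (genericInput F N t)) := by
  rw [genericG, coeff_polyOfCoeffs]
  by_cases hk : k < j + 1
  · rw [if_pos hk]
    refine extendByZero_mem_withConst (E := RecurrenceData F N t × (Fin N → F))
      (fun e i => (e.1.g i j).coeff k) (fun i => ?_) i
    refine ⟨.g i ⟨j - 1, by omega⟩ ⟨k, by simp only; omega⟩, funext fun e => ?_⟩
    simp only [genericInput, RecurrenceData.inputs, Nat.sub_add_cancel hj]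
  · rw [if_neg hk]
    exact zero_mem_withConst

/-- The result of the algorithm, as a polynomial with coefficients in the ring of functions of the
instance. -/
noncomputable def genericResult (F : Type u) [Field F] (N t : ℕ) :
    (RecurrenceData F N t × (Fin N → F) → F)[X] :=
  ((∑ i ∈ Finset.range N, C (extendByZero (fun e => e.2) i) *
    recSol (min t N) (genericG F N t) (fun i => C (extendByZero (fun e => e.1.c) i))
      (min t N + i)) * polyOfCoeffs N (extendByZero fun e => e.1.d)) %ₘ
    (X ^ N - polyOfCoeffs N (extendByZero fun e => e.1.m))

/-- Evaluation at an instance commutes with the recurrence and with division by a monic polynomial,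
so the generic result specializes to the one for `D` and `b`. -/
theorem coeff_genericResult (D : RecurrenceData F N t) {A : Matrix (Fin N) (Fin N) F}
    (hA : D.Generates A) (b : Fin N → F) (k : Fin N) :
    (genericResult F N t).coeff k (D, b) = (A.transpose.mulVec b) k := by
  set φ := Pi.evalRingHom (fun _ : RecurrenceData F N t × (Fin N → F) => F) (D, b)
  set T := min t N
  set Y := recSol T (genericG F N t) (fun i => C (extendByZero (fun e => e.1.c) i))
  have hy : ∀ i : Fin N, (Y (T + i)).map φ =
      ∑ j ∈ Finset.Icc 1 (min t (i : ℕ)), D.g i j * (Y (T + (i - j))).map φ + C (D.c i) := by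
    intro i
    have hi := i.2
    rw [show Y (T + i) = _ from recSol_add (i : ℕ), Polynomial.map_add, Polynomial.map_sum, map_C]
    congr 1
    · rw [Finset.range_eq_Ico, Finset.sum_Ico_add' (fun j => Polynomial.map φ
        (genericG F N t i j * Y (T + i - j))) 0 T 1]
      symm
      -- The full range `1 ≤ j ≤ T` adds only terms with `i < j`, which meet the leading zeros of
      -- `recSol`.
      refine (Finset.sum_subset_zero_on_sdiff (fun j hj => ?_) (fun j hj => ?_)
        fun j hj => ?_)
      · rw [Finset.mem_Icc] at hj; rw [Finset.mem_Ico]; omega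
      · simp only [Finset.mem_sdiff, Finset.mem_Ico, Finset.mem_Icc] at hj
        rw [show Y (T + i - j) = 0 from recSol_of_lt (by omega), mul_zero, Polynomial.map_zero]
      · rw [Finset.mem_Icc] at hj
        rw [Polynomial.map_mul, map_genericG (D, b) i hj.1 (by omega),
          Nat.add_sub_assoc (by omega)]
    · simp [φ, extendByZero, hi]
  rw [← hA.coeff_modByMonic (y := fun i => (Y (T + i)).map φ) hy b k, D.modulus_eq,
    ← map_polyOfCoeffs_extendByZero (fun e : RecurrenceData F N t × (Fin N → F) => e.1.m) (D, b),
    ← map_polyOfCoeffs_extendByZero (fun e : RecurrenceData F N t × (Fin N → F) => e.1.d) (D, b)]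
  change φ ((genericResult F N t).coeff k) = _
  rw [← coeff_map, genericResult, Polynomial.map_modByMonic]
  · congr 2
    · rw [Polynomial.map_mul, Polynomial.map_sum, Finset.sum_range]
      congr 1
      refine Finset.sum_congr rfl fun i _ => ?_
      rw [Polynomial.map_mul, map_C]
      simp [φ, extendByZero, Y, T]
    · rw [Polynomial.map_sub, Polynomial.map_pow, map_X]
  · refine monic_X_pow_sub (degree_lt_of_coeff_eq_zero fun k hk => ?_)
    rw [coeff_polyOfCoeffs, if_neg (not_lt.2 hk)]

theorem exists_computes_genericResult {ω K : ℝ} (hF : IsMatMulExponent F ω K) {M : ℕ → ℝ}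
    (hP : IsPolyMulCost F M) (hM : ∀ a b : ℕ, 1 ≤ a → 1 ≤ b → M a + M b ≤ M (a + b))
    (hN : 1 ≤ N) (ht : 1 ≤ t) :
    ∃ U, Computes F (Set.range (genericInput F N t)) U
        (3603 * (Nat.log 2 N + 1) * (K * ((min t N + 1 : ℕ) : ℝ) ^ ω * M N)) ∧
      Computes F (Set.range (genericInput F N t) ∪ U ∪ Set.range fun (i : Fin N) e => e.2 i)
        (Set.range (genericResult F N t).coeff)
        (1236 * (Nat.log 2 N + 1) * (((min t N + 1 : ℕ) : ℝ) ^ 2 * M N)) := by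
  -- An instance exists, so the ring of functions is nontrivial, as division by a monic polynomial
  -- demands here.
  have : Nonempty (RecurrenceData F N t × (Fin N → F)) :=
    ⟨⟨⟨fun _ _ => 0, 0, 0, 0, by simp⟩, 0⟩⟩
  have hpoly : ∀ a : RecurrenceData F N t × (Fin N → F) → Fin N → F, ∀ k, N ≤ k →
      (polyOfCoeffs N (extendByZero a)).coeff k = 0 := fun a k hk => by
    rw [coeff_polyOfCoeffs, if_neg (not_lt.2 hk)]
  have hmem : ∀ (a : RecurrenceData F N t × (Fin N → F) → Fin N → F)
      (S : Set (RecurrenceData F N t × (Fin N → F) → F)), (∀ i, (fun e => a e i) ∈ S) →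
      ∀ k, (polyOfCoeffs N (extendByZero a)).coeff k ∈ withConst F S := fun a S ha k => by
    rw [coeff_polyOfCoeffs]
    split_ifs
    · exact extendByZero_mem_withConst a ha k
    · exact zero_mem_withConst
  refine hF.exists_computes (R := RecurrenceData F N t × (Fin N → F) → F) hP.one_le hM
    (fun L _ => (hP.mulsBelow _ L).mono (Nat.le_succ L)) (by omega) (min_le_right t N) ?_
    (hpoly _) (hpoly _) ?_ ?_ ?_ (hmem _ _ fun i => ⟨.d i, rfl⟩) (hmem _ _ fun i => ⟨.m i, rfl⟩) ?_
  · intro i j k _ _ hk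
    rw [genericG, coeff_polyOfCoeffs, if_neg (by omega)]
  · intro i hi
    funext e
    simp [extendByZero, not_lt.2 hi]
  · exact fun i j k hj hjt => coeff_genericG_mem hj (by omega)
  · exact extendByZero_mem_withConst _ fun i => ⟨.c i, rfl⟩
  · exact extendByZero_mem_withConst _ fun i => ⟨i, rfl⟩

end GenericInstance

/-- A computation over a ring of functions, in two phases, as a pair of programs. -/
theorem exists_programs {F : Type*} [Field F] {E : Type*} {ι κ τ : Type} {x : ι → E → F}
    {y : κ → E → F} {U : Set (E → F)} {z : τ → E → F} {c c' : ℝ}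
    (h : Computes F (Set.range x) U c)
    (h' : Computes F (Set.range x ∪ U ∪ Set.range y) (Set.range z) c') :
    ∃ (P : SLP F ι) (Q : SLP F (ι ⊕ κ)) (out : τ → Operand F (ι ⊕ κ)),
      (P.length : ℝ) ≤ c ∧ (Q.length : ℝ) ≤ c' ∧ ∀ (e : E) (k : τ),
        (out k).eval (Sum.elim (fun i => x i e) (fun i => y i e))
          (Q.run (Sum.elim (fun i => x i e) (fun i => y i e)) (P.run (fun i => x i e) [])) =
        z k e := by
  obtain ⟨P, hP, hPU⟩ := h ι x [] (by rintro _ ⟨i, rfl⟩; exact ⟨.input i, rfl⟩)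
  obtain ⟨Q, hQ, hQz⟩ := h' (ι ⊕ κ) (Sum.elim x y) (P.run x []) (by
    rintro _ ((⟨i, rfl⟩ | ha) | ⟨i, rfl⟩)
    · exact ⟨.input (.inl i), rfl⟩
    · exact (hPU _ ha).sum_inl y
    · exact ⟨.input (.inr i), rfl⟩)
  choose out hout using fun k => hQz (z k) ⟨k, rfl⟩
  refine ⟨P, Q, out, hP, hQ, fun e k => ?_⟩
  have h1 := Operand.map_eval (Pi.evalAlgHom F (fun _ : E => F) e) (out k) (Sum.elim x y)
    (Q.run (Sum.elim x y) (P.run x []))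
  rw [hout, SLP.map_run, SLP.map_run] at h1
  have hx : (fun i => (Pi.evalAlgHom F (fun _ : E => F) e) (Sum.elim x y i)) =
      Sum.elim (fun i => x i e) (fun i => y i e) := by
    funext i
    rcases i with i | i <;> rfl
  rw [hx] at h1
  exact h1.symm

theorem mainTheorem5 (ω K : ℝ) :
    ∃ B : ℝ, ∀ (F : Type u) [Field F], IsMatMulExponent F ω K →
      ∀ M : ℕ → ℝ, IsPolyMulCost F M →
        (∀ a b : ℕ, 1 ≤ a → 1 ≤ b → M a + M b ≤ M (a + b)) →
          ∀ N t : ℕ, 2 ≤ N → 1 ≤ t →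
            ∃ (pre : SLP F (GenIndex N t)) (query : SLP F (GenIndex N t ⊕ Fin N))
              (out : Fin N → Operand F (GenIndex N t ⊕ Fin N)),
              (pre.length : ℝ) ≤ B * ((t : ℝ) ^ ω * M N * Real.log N) ∧
              (query.length : ℝ) ≤ B * ((t : ℝ) ^ 2 * M N * Real.log N) ∧
              ∀ (D : RecurrenceData F N t) (A : Matrix (Fin N) (Fin N) F), D.Generates A →
                ∀ (b : Fin N → F) (k : Fin N),
                  (out k).eval (Sum.elim D.inputs b)
                    (query.run (Sum.elim D.inputs b) (pre.run D.inputs []))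
                    = (A.transpose.mulVec b) k := by
  -- The summands are `3603 * 3` and `1236 * 3 * 4`: the factor `3` passes from `Nat.log 2 N + 1` to
  -- `Real.log N`, while `2 ^ ω` and `4 = 2 ^ 2` come from `T + 1 ≤ 2 * t`.
  refine ⟨10809 * (K * 2 ^ ω) + 14832, fun F _ hF M hP hM N t hN ht => ?_⟩
  obtain ⟨U, hU, hU'⟩ := exists_computes_genericResult (N := N) (t := t) hF hP hM (by omega) ht
  obtain ⟨pre, query, out, hpre, hquery, hout⟩ := exists_programs hU
    (hU'.mono_right (T' := Set.range fun (k : Fin N) => (genericResult F N t).coeff k) (by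
      rintro _ ⟨k, rfl⟩; exact Or.inl ⟨k, rfl⟩))
  have hω := hF.exponent_nonneg
  have hK : 1 ≤ K := by simpa using hF.sq_le le_rfl
  have hMN := hP.one_le N
  have hlog := log_two_add_one_le hN
  have hlog0 : 0 ≤ Real.log N := Real.log_natCast_nonneg N
  have hT : ((min t N + 1 : ℕ) : ℝ) ≤ 2 * t := by
    exact_mod_cast (by omega : min t N + 1 ≤ 2 * t)
  have hTω : ((min t N + 1 : ℕ) : ℝ) ^ ω ≤ 2 ^ ω * (t : ℝ) ^ ω := by
    rw [← Real.mul_rpow (by norm_num) (Nat.cast_nonneg t)]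
    exact Real.rpow_le_rpow (Nat.cast_nonneg _) hT hω
  have hT2 : ((min t N + 1 : ℕ) : ℝ) ^ 2 ≤ 4 * (t : ℝ) ^ 2 := by
    calc ((min t N + 1 : ℕ) : ℝ) ^ 2 ≤ (2 * t) ^ 2 := by gcongr
      _ = 4 * (t : ℝ) ^ 2 := by ring
  have h2ω : (0 : ℝ) < 2 ^ ω := Real.rpow_pos_of_pos (by norm_num) ω
  have htω : (0 : ℝ) ≤ (t : ℝ) ^ ω := Real.rpow_nonneg (Nat.cast_nonneg t) ω
  refine ⟨pre, query, out, hpre.trans ?_, hquery.trans ?_, fun D A hA b k => ?_⟩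
  · calc 3603 * ((Nat.log 2 N : ℝ) + 1) * (K * ((min t N + 1 : ℕ) : ℝ) ^ ω * M N)
        ≤ 3603 * (3 * Real.log N) * (K * (2 ^ ω * (t : ℝ) ^ ω) * M N) := by gcongr
      _ = 10809 * (K * 2 ^ ω) * ((t : ℝ) ^ ω * M N * Real.log N) := by ring
      _ ≤ (10809 * (K * 2 ^ ω) + 14832) * ((t : ℝ) ^ ω * M N * Real.log N) := by
        gcongr
        linarith
  · calc 1236 * ((Nat.log 2 N : ℝ) + 1) * (((min t N + 1 : ℕ) : ℝ) ^ 2 * M N)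
        ≤ 1236 * (3 * Real.log N) * (4 * (t : ℝ) ^ 2 * M N) := by gcongr
      _ = 14832 * ((t : ℝ) ^ 2 * M N * Real.log N) := by ring
      _ ≤ (10809 * (K * 2 ^ ω) + 14832) * ((t : ℝ) ^ 2 * M N * Real.log N) := by
        gcongr
        have : 0 ≤ K * 2 ^ ω := by positivity
        linarith
  · exact (hout (D, b) k).trans (coeff_genericResult D hA b k)
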